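/- Let $d\ge 0$ and $m\ge 1$ be integers, let $H$ be a subgroup of $\mathrm{GL}(d)=\mathrm{GL}(\mathbb R^d)$, and let $G=H\ltimes\mathbb R^d$ act on the space $\mathfrak X(\mathbb R^d)=C^\infty(\mathbb R^d,\mathbb R^d)$ of smooth vector fields (a Fréchet space for uniform convergence on compact sets of all derivatives) by $((A,b)\cdot f)(x)=A f(A^{-1}(x-b))$. A map $\varphi\colon\mathfrak X(\mathbb R^d)\to\mathfrak X(\mathbb R^d)$ is called *local* if it does not increase supports, $\operatorname{supp}\varphi(f)\subset\operatorname{supp} f$, and $\varphi(f)(x)$ depends only on the germ of $f$ at $x$. A map of $m$ vector fields is called local if $\operatorname{supp}L(f_1,\dots,f_m)\subset\bigcup_i\operatorname{supp}f_i$ and $L(f_1,\dots,f_m)(x)$ depends only on the germs of $f_1,\dots,f_m$ at $x$. For a symmetric $m$-linear map $L$ put $\mathcal P(L)(f)=L(f,\dots,f)$. The *Taylor terms of order $m$* are the maps $\mathcal P(D^m\varphi(0))$, where $\varphi$ runs through the smooth, local, $G$-equivariant maps $\mathfrak X(\mathbb R^d)\to\mathfrak X(\mathbb R^d)$. Write $M=\mathbb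 R^d$. A *composition* is a finitely supported map $\kappa\colon\mathbb N\to\mathbb N$, with size $|\kappa|=\sum_j\kappa(j)$, and $$\mathrm{Sym}_\kappa = M\otimes\bigotimes_{j\ge 0}S^{\kappa(j)}(M^*\otimes S^jM)\cong\mathrm{Lin}\Bigl(\bigotimes_{j\ge 0} S^{\kappa(j)}(M\otimes S^jM^*),\,M\Bigr),$$ that is, the space of multilinear maps into $M$ that take, for every $j$, $\kappa(j)$ arguments in the space $M\otimes S^jM^*$ of symmetric $j$-linear maps $M^j\to M$ and are symmetric in these $\kappa(j)$ arguments. $\mathrm{Sym}_\kappa^H$ is its subspace of $H$-invariant elements for the tensor product action. Let $\mathrm{Lin}^{\mathrm{loc}}_G$ be the space of symmetric, continuous $m$-linear, local, $G$-equivariant maps $\mathfrak X(\mathbb R^d)^m\to\mathfrak X(\mathbb R^d)$. Then there is a linear bijection $$J\colon \mathrm{Lin}^{\mathrm{loc}}_G\to\bigoplus_{|\kappa|=m}\mathrm{Sym}_\kappa^H ,$$ the restriction to jets at the origin: for every $L$ there are $k\in\mathbb N$ and an $m$-linear map $\ell$ on the space $\bigoplus_{j\le k}M\otimes S^jM^*$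 of $k$-jets at $0$ with $L(f_1,\dots,f_m)(0)=\ell(j^k_0f_1,\dots,j^k_0f_m)$ for all $f_1,\dots,f_m$, and the component $J(L)_\kappa$ is $\ell$ evaluated on arguments of which exactly $\kappa(j)$ lie in $M\otimes S^jM^*$ for each $j$ (so it is zero if $\kappa(j)\ne0$ for some $j>k$). Moreover $\mathcal P\circ J^{-1}$ is a linear bijection from $\bigoplus_{|\kappa|=m}\mathrm{Sym}_\kappa^H$ onto the space of Taylor terms of order $m$ at the zero vector field of smooth, local, $G$-equivariant maps $\mathfrak X(\mathbb R^d)\to\mathfrak X(\mathbb R^d)$. -/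

import Mathlib

open scoped ContDiff Topology DirectSum
open Filter

noncomputable section

namespace AffineTaylor

/-- The affine space `ℝ^d`, also used as its own tangent space at the origin. -/
abbrev Pt (d : ℕ) : Type := EuclideanSpace ℝ (Fin d)

/-- Smooth vector fields on `ℝ^d`, as a linear subspace of all maps `ℝ^d → ℝ^d`. -/
def smoothFields (d : ℕ) : Submodule ℝ (Pt d → Pt d) where
  carrier := {f | ContDiff ℝ ∞ f}
  add_mem' {f g} hf hg := by
    have h1 : ContDiff ℝ ∞ f := hf
    have h2 : ContDiff ℝ ∞ g := hg
    exact h1.add h2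
  zero_mem' := by
    change ContDiff ℝ ∞ fun _ => 0
    exact contDiff_const
  smul_mem' c f hf := by
    have h1 : ContDiff ℝ ∞ f := hf
    exact h1.const_smul c

/-- The space of smooth vector fields on `ℝ^d`. It is a separate type so that it does not
inherit the topology of pointwise convergence. -/
def VF (d : ℕ) : Type := smoothFields d

variable {d : ℕ}

instance : AddCommGroup (VF d) := inferInstanceAs (AddCommGroup (smoothFields d))

instance : Module ℝ (VF d) := inferInstanceAs (Module ℝ (smoothFields d))

instance : CoeFun (VF d) (fun _ => Pt d → Pt d) := ⟨fun f => f.1⟩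

theorem VF.contDiff (f : VF d) : ContDiff ℝ ∞ (f : Pt d → Pt d) := f.2

theorem VF.coe_add (f g : VF d) : ((f + g : VF d) : Pt d → Pt d) = f + g := rfl

theorem VF.coe_smul (c : ℝ) (f : VF d) : ((c • f : VF d) : Pt d → Pt d) = c • (f : Pt d → Pt d) :=
  rfl

/-- The `k`-th derivative of a vector field, as a continuous map on `ℝ^d`. It depends linearly
on the vector field. -/
def VF.iterD (k : ℕ) : VF d →ₗ[ℝ] C(Pt d, Pt d [×k]→L[ℝ] Pt d) where
  toFun f := ⟨iteratedFDeriv ℝ k f,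
    f.contDiff.continuous_iteratedFDeriv (by exact_mod_cast le_top)⟩
  map_add' f g := by
    ext1 x
    exact iteratedFDeriv_add_apply (f.contDiff.of_le (by exact_mod_cast le_top)).contDiffAt
      (g.contDiff.of_le (by exact_mod_cast le_top)).contDiffAt
  map_smul' c f := by
    ext1 x
    exact iteratedFDeriv_const_smul_apply
      (f.contDiff.of_le (by exact_mod_cast le_top)).contDiffAt

/-- The Fréchet topology: uniform convergence on compact sets of all derivatives. -/
instance : TopologicalSpace (VF d) :=
  ⨅ k : ℕ, TopologicalSpace.induced (VF.iterD (d := d) k) inferInstance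

instance : IsTopologicalAddGroup (VF d) :=
  topologicalAddGroup_iInf fun k => topologicalAddGroup_induced (VF.iterD (d := d) k)

instance : ContinuousSMul ℝ (VF d) :=
  continuousSMul_iInf fun k => continuousSMul_induced (VF.iterD (d := d) k)

/-! ### Smooth maps between vector fields and their derivatives -/

/-- `D k σ (τ₁, …, τₖ)` is the `k`-th derivative of `φ` at `σ` in the directions `τ₁, …, τₖ`, and
all derivatives are jointly continuous: the usual notion of a smooth map between Fréchet spaces,
with `⟨Dψ(σ), τ⟩ = lim (ψ(σ + ετ) - ψ(σ)) / ε`. -/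
structure HasDerivatives (φ : VF d → VF d) (D : (k : ℕ) → VF d → (Fin k → VF d) → VF d) :
    Prop where
  zero : ∀ σ v, D 0 σ v = φ σ
  succ : ∀ k σ τ v, Tendsto (fun ε : ℝ => ε⁻¹ • (D k (σ + ε • τ) v - D k σ v)) (𝓝[≠] 0)
    (𝓝 (D (k + 1) σ (Fin.cons τ v)))
  continuous : ∀ k, Continuous fun p : VF d × (Fin k → VF d) => D k p.1 p.2

/-- `φ` is smooth and `T` is its `m`-th derivative at the zero vector field. -/
def IsSmoothWithTaylorTerm (m : ℕ) (φ : VF d → VF d) (T : (Fin m → VF d) → VF d) : Prop :=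
  ∃ D, HasDerivatives φ D ∧ T = D m 0

/-! ### Locality and equivariance -/

/-- A map on vector fields is local if it does not increase supports and the value at a point
only depends on the germ of the vector field at that point. -/
def IsLocal (φ : VF d → VF d) : Prop :=
  (∀ f : VF d, tsupport (φ f) ⊆ tsupport f) ∧
    ∀ (f g : VF d) (x : Pt d), (f : Pt d → Pt d) =ᶠ[𝓝 x] g → φ f x = φ g x

/-- Locality of a map of several vector fields, seen as a map on sections of the `m`-fold
direct sum of the tangent bundle. -/
def IsLocalMulti {m : ℕ} (L : (Fin m → VF d) → VF d) : Prop :=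
  (∀ f : Fin m → VF d, tsupport (L f) ⊆ ⋃ i, tsupport (f i)) ∧
    ∀ (f g : Fin m → VF d) (x : Pt d), (∀ i, (f i : Pt d → Pt d) =ᶠ[𝓝 x] g i) → L f x = L g x

/-- The action of the affine transformation `x ↦ A x + b` on vector fields. -/
def affAct (A : Pt d ≃L[ℝ] Pt d) (b : Pt d) (f : VF d) : VF d :=
  ⟨fun x => A (f (A.symm (x - b))),
    A.contDiff.comp (f.contDiff.comp (A.symm.contDiff.comp (contDiff_id.sub contDiff_const)))⟩

/-- Equivariance under `G = H ⋉ ℝ^d`. -/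
def IsEquivariant (H : Subgroup (Pt d ≃L[ℝ] Pt d)) (φ : VF d → VF d) : Prop :=
  ∀ A ∈ H, ∀ (b : Pt d) (f : VF d), φ (affAct A b f) = affAct A b (φ f)

/-- The homogeneous polynomial `f ↦ L(f, …, f)` of an `m`-linear map `L`. -/
def homPoly {m : ℕ} (L : (Fin m → VF d) → VF d) : VF d → VF d := fun f => L fun _ => f

/-- The Taylor terms of order `m` at the zero vector field of smooth, local, `G`-equivariant
maps. -/
def taylorTerms (H : Subgroup (Pt d ≃L[ℝ] Pt d)) (m : ℕ) : Set (VF d → VF d) :=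
  {p | ∃ φ T, IsLocal φ ∧ IsEquivariant H φ ∧ IsSmoothWithTaylorTerm m φ T ∧ p = homPoly T}

/-- The space of symmetric, (continuous) `m`-linear, local, `G`-equivariant maps on vector
fields. -/
def linLoc (H : Subgroup (Pt d ≃L[ℝ] Pt d)) (m : ℕ) :
    Submodule ℝ (ContinuousMultilinearMap ℝ (fun _ : Fin m => VF d) (VF d)) where
  carrier := {L | (∀ (σ : Equiv.Perm (Fin m)) (f : Fin m → VF d), L (fun i => f (σ i)) = L f) ∧
    IsLocalMulti L ∧
    ∀ A ∈ H, ∀ (b : Pt d) (f : Fin m → VF d), L (fun i => affAct A b (f i)) = affAct A b (L f)}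
  add_mem' := by
    rintro L L' ⟨h1, ⟨h2, h3⟩, h4⟩ ⟨h1', ⟨h2', h3'⟩, h4'⟩
    refine ⟨fun σ f => ?_, ⟨fun f => ?_, fun f g x h => ?_⟩, fun A hA b f => ?_⟩
    · simp only [add_apply, h1, h1']
    · rw [add_apply, VF.coe_add]
      exact (tsupport_add _ _).trans (Set.union_subset (h2 f) (h2' f))
    · simp only [add_apply, VF.coe_add, Pi.add_apply, h3 f g x h,
        h3' f g x h]
    · rw [add_apply, add_apply, h4 A hA,
        h4' A hA]
      exact Subtype.ext (funext fun x => (map_add A _ _).symm)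
  zero_mem' := by
    refine ⟨fun σ f => rfl, ⟨fun f => ?_, fun f g x h => rfl⟩, fun A hA b f => ?_⟩
    · have : (((0 : ContinuousMultilinearMap ℝ (fun _ : Fin m => VF d) (VF d)) f : VF d) :
        Pt d → Pt d) = 0 := rfl
      rw [this, tsupport_zero]
      exact Set.empty_subset _
    · exact Subtype.ext (funext fun x => (map_zero A).symm)
  smul_mem' := by
    rintro c L ⟨h1, ⟨h2, h3⟩, h4⟩
    refine ⟨fun σ f => ?_, ⟨fun f => ?_, fun f g x h => ?_⟩, fun A hA b f => ?_⟩
    · simp only [smul_apply, h1]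
    · rw [smul_apply, VF.coe_smul]
      exact (closure_mono (Function.support_const_smul_subset c _)).trans (h2 f)
    · simp only [smul_apply, VF.coe_smul, Pi.smul_apply, h3 f g x h]
    · rw [smul_apply, smul_apply, h4 A hA]
      exact Subtype.ext (funext fun x => (map_smul A c _).symm)

/-! ### Jets at the origin -/

/-- `ℝ^d ⊗ S^j (ℝ^d)^*`: the symmetric `j`-linear maps from `ℝ^d` to itself. -/
def symJet (d j : ℕ) : Submodule ℝ (Pt d [×j]→L[ℝ] Pt d) where
  carrier := {z | ∀ (σ : Equiv.Perm (Fin j)) (v : Fin j → Pt d), z (v ∘ σ) = z v}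
  add_mem' h h' σ v := by simp [h σ v, h' σ v]
  zero_mem' _ _ := rfl
  smul_mem' c _ h σ v := by simp [h σ v]

/-- The derivatives of a smooth map are symmetric. -/
theorem iteratedFDeriv_perm {f : Pt d → Pt d} (hf : ContDiff ℝ ∞ f) (n : ℕ) :
    ∀ (σ : Equiv.Perm (Fin n)) (x : Pt d) (v : Fin n → Pt d),
      iteratedFDeriv ℝ n f x (v ∘ σ) = iteratedFDeriv ℝ n f x v := by
  have hswap : ∀ n : ℕ, ∀ (i : Fin n) (x : Pt d) (v : Fin (n + 1) → Pt d),
      iteratedFDeriv ℝ (n + 1) f x (v ∘ Equiv.swap i.castSucc i.succ) =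
        iteratedFDeriv ℝ (n + 1) f x v := by
    intro n
    induction n with
    | zero => exact fun i => i.elim0
    | succ n ih =>
      intro i x v
      have hd : ∀ k : ℕ, ContDiff ℝ ∞ (iteratedFDeriv ℝ k f) := fun k =>
        hf.iteratedFDeriv_right (m := ∞) (by exact_mod_cast le_top)
      induction i using Fin.cases with
      | zero =>
        have key : ∀ w : Fin (n + 2) → Pt d, iteratedFDeriv ℝ (n + 2) f x w =
            fderiv ℝ (fderiv ℝ (iteratedFDeriv ℝ n f)) x (w 0) (w 1) (Fin.tail (Fin.tail w)) := by
          intro w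
          rw [iteratedFDeriv_succ_apply_left, iteratedFDeriv_succ_eq_comp_left]
          rw [LinearIsometryEquiv.comp_fderiv']
          rfl
        have hs : IsSymmSndFDerivAt ℝ (iteratedFDeriv ℝ n f) x :=
          (hd n).contDiffAt.isSymmSndFDerivAt (by
            simpa using (WithTop.coe_le_coe.2 (le_top : (2 : ℕ∞) ≤ ⊤)))
        rw [key, key]
        have h0 : (v ∘ Equiv.swap (Fin.castSucc (0 : Fin (n + 1))) (Fin.succ 0)) 0 = v 1 := by
          simp
        have h1 : (v ∘ Equiv.swap (Fin.castSucc (0 : Fin (n + 1))) (Fin.succ 0)) 1 = v 0 := by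
          simp
        have h2 : Fin.tail (Fin.tail (v ∘ Equiv.swap (Fin.castSucc (0 : Fin (n + 1)))
            (Fin.succ 0))) = Fin.tail (Fin.tail v) := by
          funext j
          simp only [Fin.tail, Function.comp_apply]
          rw [Equiv.swap_apply_of_ne_of_ne]
          · simp [Fin.ext_iff]
          · simp [Fin.ext_iff]
        rw [h0, h1, h2, hs.eq]
      | succ i =>
        have key : ∀ w : Fin (n + 2) → Pt d, iteratedFDeriv ℝ (n + 2) f x w =
            fderiv ℝ (fun y => iteratedFDeriv ℝ (n + 1) f y (Fin.tail w)) x (w 0) := by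
          intro w
          rw [iteratedFDeriv_succ_apply_left]
          rw [fderiv_continuousMultilinear_apply_const_apply]
          exact ((hd (n + 1)).differentiable (by simp)).differentiableAt
        rw [key, key]
        have h0 : (v ∘ Equiv.swap (Fin.castSucc i.succ) (Fin.succ i.succ)) 0 = v 0 := by
          simp only [Function.comp_apply]
          rw [Equiv.swap_apply_of_ne_of_ne] <;> simp [Fin.ext_iff]
        have h1 : Fin.tail (v ∘ Equiv.swap (Fin.castSucc i.succ) (Fin.succ i.succ)) =
            Fin.tail v ∘ Equiv.swap i.castSucc i.succ := by
          funext j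
          simp only [Fin.tail, Function.comp_apply, ← Fin.succ_castSucc]
          congr 1
          exact (Fin.succ_injective _).swap_apply _ _ _
        rw [h0, h1]
        simp only [ih]
  intro σ
  cases n with
  | zero => exact fun x v => congrArg _ (funext fun i => i.elim0)
  | succ n =>
    have hσ : σ ∈ Submonoid.closure
        (Set.range fun i : Fin n => Equiv.swap i.castSucc i.succ) := by
      rw [Equiv.Perm.mclosure_swap_castSucc_succ]
      trivial
    induction hσ using Submonoid.closure_induction with
    | mem _ h =>
      obtain ⟨i, rfl⟩ := h
      exact hswap n i
    | one => exact fun x v => rfl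
    | mul a b _ _ ha hb =>
      intro x v
      rw [Equiv.Perm.coe_mul, ← Function.comp_assoc, hb, ha]

/-- The degree-`j` part of the jet at the origin: the `j`-th derivative at `0`. -/
def jetPart (j : ℕ) (f : VF d) : symJet d j :=
  ⟨iteratedFDeriv ℝ j f 0, fun σ v => iteratedFDeriv_perm f.contDiff j σ 0 v⟩

/-- The space of `k`-jets of vector fields at the origin, `ℝ^d ⊗ ⨁_{j ≤ k} S^j (ℝ^d)^*`. -/
abbrev Jet (d k : ℕ) : Type := (j : Fin (k + 1)) → symJet d j

/-- The `k`-jet of a vector field at the origin. -/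
def jet (k : ℕ) (f : VF d) : Jet d k := fun j => jetPart j f

/-- The homogeneous part of degree `j`, put into the space of `k`-jets (zero if `j > k`). -/
def jetSingle (k j : ℕ) (z : symJet d j) : Jet d k :=
  if h : j < k + 1 then Pi.single (⟨j, h⟩ : Fin (k + 1)) z else 0

/-- The action of a linear map on `ℝ^d ⊗ S^j (ℝ^d)^*`:
`(A ⬝ z)(x₁, …, xⱼ) = A (z (A⁻¹ x₁, …, A⁻¹ xⱼ))`. -/
def jetAct (A : Pt d ≃L[ℝ] Pt d) (j : ℕ) (z : symJet d j) : symJet d j :=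
  ⟨(A : Pt d →L[ℝ] Pt d).compContinuousMultilinearMap
      (z.1.compContinuousLinearMap fun _ => (A.symm : Pt d →L[ℝ] Pt d)),
    fun σ v => congrArg A (z.2 σ fun i => A.symm (v i))⟩

/-! ### The spaces attached to compositions -/

/-- The space `Sym_κ` of a composition `κ`, that is
`ℝ^d ⊗ ⨂_j S^{κ(j)} ((ℝ^d)^* ⊗ S^j ℝ^d) = Lin (⨂_j S^{κ(j)} (ℝ^d ⊗ S^j (ℝ^d)^*), ℝ^d)`:
multilinear maps with values in `ℝ^d` that take, for every `j`, `κ(j)` arguments in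
`ℝ^d ⊗ S^j (ℝ^d)^*` and are symmetric in these `κ(j)` arguments. -/
def symSpace (d : ℕ) (κ : ℕ →₀ ℕ) :
    Submodule ℝ (MultilinearMap ℝ (fun p : (Σ j : ℕ, Fin (κ j)) => symJet d p.1) (Pt d)) where
  carrier := {s | ∀ (σ : ∀ j, Equiv.Perm (Fin (κ j)))
    (z : (p : Σ j : ℕ, Fin (κ j)) → symJet d p.1), s (fun p => z ⟨p.1, σ p.1 p.2⟩) = s z}
  add_mem' h h' σ z := by simp only [add_apply, h σ z, h' σ z]
  zero_mem' _ _ := rfl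
  smul_mem' c _ h σ z := by simp only [smul_apply, h σ z]

/-- The subspace `Sym_κ^H` of the elements of `Sym_κ` that are invariant under the action
`(A ⬝ s)(z) = A (s (A⁻¹ ⬝ z))` of `H`. -/
def symInv (κ : ℕ →₀ ℕ) (H : Subgroup (Pt d ≃L[ℝ] Pt d)) :
    Submodule ℝ (MultilinearMap ℝ (fun p : (Σ j : ℕ, Fin (κ j)) => symJet d p.1) (Pt d)) where
  carrier := {s | s ∈ symSpace d κ ∧
    ∀ A ∈ H, ∀ z, A (s fun p => jetAct A⁻¹ p.1 (z p)) = s z}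
  add_mem' h h' := ⟨add_mem h.1 h'.1, fun A hA z => by
    simp only [add_apply, map_add, h.2 A hA z, h'.2 A hA z]⟩
  zero_mem' := ⟨zero_mem _, fun A _ _ => map_zero A⟩
  smul_mem' c _ h := ⟨Submodule.smul_mem _ c h.1, fun A hA z => by
    simp only [smul_apply, map_smul, h.2 A hA z]⟩

/-- The direct sum of the spaces `Sym_κ^H` over all compositions `κ` of size `m`. -/
abbrev SymSum (H : Subgroup (Pt d ≃L[ℝ] Pt d)) (m : ℕ) : Type :=
  ⨁ κ : {κ : ℕ →₀ ℕ // κ.degree = m}, symInv κ.1 H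

/-- `s` is the restriction of `L` to jets at the origin: for some `k` the value of `L` at the
origin is an `m`-linear function `ℓ` of the `k`-jets at the origin, and the component `s_κ` is
`ℓ` evaluated on jets of which `κ(j)` are homogeneous of degree `j`, for every `j`. -/
def IsJetRestriction {H : Subgroup (Pt d ≃L[ℝ] Pt d)} {m : ℕ} (L : (Fin m → VF d) → VF d)
    (s : SymSum H m) : Prop :=
  ∃ (k : ℕ) (ℓ : MultilinearMap ℝ (fun _ : Fin m => Jet d k) (Pt d)),
    (∀ f : Fin m → VF d, L f 0 = ℓ fun i => jet k (f i)) ∧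
    ∀ (κ : {κ : ℕ →₀ ℕ // κ.degree = m}) (e : Fin m ≃ Σ j : ℕ, Fin (κ.1 j))
      (z : (p : Σ j : ℕ, Fin (κ.1 j)) → symJet d p.1),
      (s κ : MultilinearMap ℝ (fun p : (Σ j : ℕ, Fin (κ.1 j)) => symJet d p.1) (Pt d)) z =
        ℓ fun i => jetSingle k (e i).1 (z (e i))

end AffineTaylor

end

open AffineTaylor

/-!
A homogeneous polynomial determines its symmetric multilinear map by polarization. It is smooth, its
`m`-th derivative at zero is the symmetrization of that map, and locality and equivariance pass to
derivatives; hence the Taylor terms of order `m` are the homogeneous polynomials of the local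
equivariant symmetric multilinear maps.

A continuous multilinear map that depends only on germs has finite order at the origin, by a
multilinear version of Peetre's argument: by continuity it is controlled by finitely many
derivatives, and a germ with vanishing `k`-jet has representatives that are arbitrarily small in
`C^k`, so scaling such an argument shows that the value vanishes. The value at the origin is
therefore a multilinear function of `k`-jets, which by translation equivariance determines the
map and by linear equivariance is invariant under `H`. Evaluating on homogeneous polynomial vector
fields splits it into its components in the spaces `Sym_κ^H`. Conversely, an element of `Sym_κ^H`,
applied to the jets at every point and symmetrized, is a local equivariant operator whose only
component is a nonzero multiple of the given element.
-/

noncomputable section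

namespace AffineTaylor

/-! ### Multilinear maps -/

section Multilinear

variable {ι : Type*}

theorem map_eq_map_of_sub_mem {R N : Type*} {M : ι → Type*} [Finite ι] [Ring R]
    [∀ i, AddCommGroup (M i)] [∀ i, Module R (M i)] [AddCommGroup N] [Module R N]
    {L : MultilinearMap R M N} {K : ∀ i, Set (M i)} (hK : ∀ f, ∀ i, f i ∈ K i → L f = 0)
    {f g : ∀ i, M i} (h : ∀ i, f i - g i ∈ K i) : L f = L g := by
  classical
  cases nonempty_fintype ι
  rw [← sub_add_cancel f g, L.map_add_univ, Finset.sum_eq_single ∅ _ (by simp),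
    Finset.piecewise_empty]
  intro s _ hs
  obtain ⟨i, hi⟩ := Finset.nonempty_iff_ne_empty.2 hs
  exact hK _ i (by simpa [hi] using h i)

variable {R E F : Type*} [Semiring R] [AddCommMonoid E] [Module R E] [TopologicalSpace E]
  [AddCommMonoid F] [Module R F] [TopologicalSpace F]

/-- Symmetry of a multilinear map in all its arguments. -/
def IsSymm (L : ContinuousMultilinearMap R (fun _ : ι => E) F) : Prop :=
  ∀ (σ : Equiv.Perm ι) (f : ι → E), L (fun i => f (σ i)) = L f

theorem IsSymm.map_comp_equiv {κ : Type*} {L : ContinuousMultilinearMap R (fun _ : ι => E) F}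
    (hL : IsSymm L) (e e' : ι ≃ κ) (f : κ → E) : L (fun i => f (e i)) = L fun i => f (e' i) := by
  simpa using hL (e.trans e'.symm) fun i => f (e' i)

/-- The symmetrization of a multilinear map, as the sum over all permutations of the arguments. It
is not normalized: it multiplies a symmetric map of `n` arguments by `n!`. -/
def symmetrize [Fintype ι] [DecidableEq ι] [ContinuousAdd F]
    (L : ContinuousMultilinearMap R (fun _ : ι => E) F) :
    ContinuousMultilinearMap R (fun _ : ι => E) F :=
  ∑ σ : Equiv.Perm ι, L.domDomCongr σ

variable [Fintype ι] [DecidableEq ι] [ContinuousAdd F]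
  (L : ContinuousMultilinearMap R (fun _ : ι => E) F)

theorem symmetrize_apply (f : ι → E) :
    symmetrize L f = ∑ σ : Equiv.Perm ι, L fun i => f (σ i) := by
  simp only [symmetrize, sum_apply, ContinuousMultilinearMap.domDomCongr_apply]

theorem isSymm_symmetrize : IsSymm (symmetrize L) := fun σ f => by
  simpa only [symmetrize_apply, Equiv.coe_mulLeft, Equiv.Perm.mul_apply] using
    Equiv.sum_comp (Equiv.mulLeft σ) fun τ : Equiv.Perm ι => L fun i => f (τ i)

variable {L}

theorem IsSymm.symmetrize_apply (hL : IsSymm L) (f : ι → E) :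
    symmetrize L f = (Fintype.card ι).factorial • L f := by
  simp only [AffineTaylor.symmetrize_apply, fun σ => hL σ f, Finset.sum_const, Finset.card_univ,
    Fintype.card_perm]

end Multilinear

section RealMultilinear

variable {ι E F : Type*} [AddCommGroup E] [Module ℝ E] [TopologicalSpace E]

theorem tendsto_slope_multilinear [Fintype ι] [DecidableEq ι] [AddCommGroup F] [Module ℝ F]
    [TopologicalSpace F] [ContinuousAdd F] [ContinuousSMul ℝ F]
    (L : ContinuousMultilinearMap ℝ (fun _ : ι => E) F) (w u : ι → E) :
    Tendsto (fun ε : ℝ => ε⁻¹ • (L (w + ε • u) - L w)) (𝓝[≠] 0)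
      (𝓝 (∑ i, L (Function.update w i (u i)))) := by
  have scale : ∀ (ε : ℝ) (s : Finset ι),
      L (s.piecewise (ε • u) w) = ε ^ s.card • L (s.piecewise u w) := fun ε s => by
    rw [← Finset.prod_const, ← L.map_piecewise_smul]
    congr 1
    ext i
    by_cases hi : i ∈ s <;> simp [hi]
  have expansion : ∀ ε : ℝ, ε ≠ 0 → ε⁻¹ • (L (w + ε • u) - L w) =
      ∑ i, L (Function.update w i (u i)) +
        ∑ s : Finset ι with 2 ≤ s.card, ε ^ (s.card - 1) • L (s.piecewise u w) := fun ε hε => by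
    have h := L.toMultilinearMap.map_add_eq_map_add_linearDeriv_add w (ε • u)
    simp only [map_smul, MultilinearMap.linearDeriv_apply, ContinuousMultilinearMap.coe_coe,
      scale] at h
    rw [h, add_assoc, add_sub_cancel_left, smul_add, inv_smul_smul₀ hε, Finset.smul_sum]
    congr 1
    refine Finset.sum_congr rfl fun s hs => ?_
    have hs : 2 ≤ s.card := (Finset.mem_filter.1 hs).2
    rw [smul_smul, inv_mul_eq_div, pow_sub₀ ε hε (by lia), pow_one, div_eq_mul_inv]
  have limit : Continuous fun ε : ℝ => ∑ i, L (Function.update w i (u i)) +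
      ∑ s : Finset ι with 2 ≤ s.card, ε ^ (s.card - 1) • L (s.piecewise u w) := by fun_prop
  have value : ∑ s : Finset ι with 2 ≤ s.card, (0 : ℝ) ^ (s.card - 1) • L (s.piecewise u w) = 0 :=
    Finset.sum_eq_zero fun s hs => by
      have hs : 2 ≤ s.card := (Finset.mem_filter.1 hs).2
      rw [zero_pow (by lia), zero_smul]
  have h := tendsto_nhdsWithin_of_tendsto_nhds (s := {0}ᶜ) (limit.tendsto 0)
  rw [value, add_zero] at h
  exact h.congr' (eventually_nhdsWithin_of_forall fun ε hε => (expansion ε hε).symm)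

/-- If an argument can be made arbitrarily small without changing the value of the map, then
multilinearity lets this value be scaled while the arguments stay in a neighbourhood where the map
is bounded. -/
theorem exists_nhds_zero_map_eq_zero [Finite ι] [DecidableEq ι] [ContinuousSMul ℝ E]
    [NormedAddCommGroup F] [NormedSpace ℝ F]
    (L : ContinuousMultilinearMap ℝ (fun _ : ι => E) F) :
    ∃ U ∈ 𝓝 (0 : E), ∀ (f : ι → E) (i : ι),
      (∀ c : ℝ, c ≠ 0 → ∃ g, L (Function.update f i g) = L f ∧ c • g ∈ U) → L f = 0 := by
  cases nonempty_fintype ι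
  rcases isEmpty_or_nonempty ι with hι | hι
  · exact ⟨Set.univ, univ_mem, fun _ i => (hι.false i).elim⟩
  have hL : {f | ‖L f‖ < 1} ∈ 𝓝 (0 : ι → E) :=
    (L.cont.norm.tendsto 0).eventually_lt_const (by simp)
  rw [nhds_pi, mem_pi'] at hL
  obtain ⟨_, U, hU, hUL⟩ := hL
  refine ⟨⋂ i, U i, iInter_mem.2 hU, fun f i hf => by_contra fun h0 => ?_⟩
  obtain ⟨s, hs, hsf⟩ : ∃ s : ℝ, s ≠ 0 ∧ ∀ j, s • f j ∈ U j := by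
    have : ∀ᶠ s : ℝ in 𝓝[≠] 0, ∀ j, s • f j ∈ U j := eventually_all.2 fun j =>
      nhdsWithin_le_nhds <| (continuous_id.smul continuous_const).tendsto' (0 : ℝ) (0 : E)
        (zero_smul ℝ (f j)) (hU j)
    exact (eventually_mem_nhdsWithin.and this).exists
  set n := Fintype.card ι
  have hpos : ‖s ^ n • L f‖ ≠ 0 := norm_ne_zero_iff.2 (smul_ne_zero (pow_ne_zero _ hs) h0)
  obtain ⟨g, hg, hgU⟩ := hf (s * ‖s ^ n • L f‖⁻¹) (mul_ne_zero hs (inv_ne_zero hpos))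
  have hlt : ‖L (s • Function.update f i (‖s ^ n • L f‖⁻¹ • g))‖ < 1 := by
    refine hUL fun j _ => ?_
    rcases eq_or_ne j i with rfl | hj
    · simpa [smul_smul] using Set.mem_iInter.1 hgU j
    · simpa [hj] using hsf j
  have hval : L (s • Function.update f i (‖s ^ n • L f‖⁻¹ • g)) =
      ‖s ^ n • L f‖⁻¹ • s ^ n • L f := by
    rw [show s • Function.update f i (‖s ^ n • L f‖⁻¹ • g) =
      fun j => s • Function.update f i (‖s ^ n • L f‖⁻¹ • g) j from rfl,
      L.map_smul_univ (fun _ => s), L.map_update_smul, hg, smul_comm]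
    simp [n]
  rw [hval, norm_smul, norm_inv, norm_norm, inv_mul_cancel₀ hpos] at hlt
  exact hlt.false

end RealMultilinear

theorem exists_sigmaCongrRight_eq {ι : Type*} {α : ι → Type*} (g : Equiv.Perm (Σ i, α i))
    (hg : ∀ p, (g p).1 = p.1) :
    ∃ σ : ∀ i, Equiv.Perm (α i), Equiv.sigmaCongrRight σ = g := by
  refine ⟨fun i => (Equiv.sigmaSubtype i).symm.trans
    ((g.subtypeEquiv fun p => by rw [hg]).trans (Equiv.sigmaSubtype i)), ?_⟩
  ext ⟨i, a⟩ : 1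
  exact congrArg Subtype.val
    ((Equiv.sigmaSubtype i).symm_apply_apply ⟨g ⟨i, a⟩, hg ⟨i, a⟩⟩)

/-! ### Derivatives of smooth maps between normed spaces -/

section Calculus

variable {E F : Type*} [NormedAddCommGroup E] [NormedSpace ℝ E] [NormedAddCommGroup F]
  [NormedSpace ℝ F]

theorem hasDerivAt_diagonal {f f₁ f₂ : ℝ → ℝ → F}
    (h₁ : ∀ r s, HasDerivAt (fun r => f r s) (f₁ r s) r)
    (h₂ : ∀ r s, HasDerivAt (f r) (f₂ r s) s)
    (hc₁ : Continuous fun p : ℝ × ℝ => f₁ p.1 p.2) (hc₂ : Continuous fun p : ℝ × ℝ => f₂ p.1 p.2)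
    (r : ℝ) : HasDerivAt (fun r => f r r) (f₁ r r + f₂ r r) r := by
  have hspan := (ContinuousLinearMap.toSpanSingletonCLE (𝕜 := ℝ) (E := F)).continuous
  have key := hasStrictFDerivAt_uncurry_coprod (𝕜 := ℝ) (f := f) (u := (r, r))
    (f₁ := fun r s => .toSpanSingleton ℝ (f₁ r s)) (f₂ := fun r s => .toSpanSingleton ℝ (f₂ r s))
    (Eventually.of_forall fun p => (h₁ p.1 p.2).hasFDerivAt)
    (Eventually.of_forall fun p => (h₂ p.1 p.2).hasFDerivAt)
    (hspan.comp hc₁).continuousAt (hspan.comp hc₂).continuousAt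
  simpa [Function.HasUncurry.uncurry] using! key.hasFDerivAt.comp_hasDerivAt
    (f := fun r : ℝ => (r, r)) r ((hasDerivAt_id r).prodMk (hasDerivAt_id r))

theorem contDiff_diagonal {j : ℕ} (z : E [×j]→L[ℝ] F) {n : WithTop ℕ∞} :
    ContDiff ℝ n fun x => z fun _ => x :=
  z.contDiff.comp (contDiff_pi.2 fun _ => contDiff_id)

theorem iteratedFDeriv_diagonal_zero [CompleteSpace F] {j : ℕ} {z : E [×j]→L[ℝ] F} (hz : IsSymm z)
    (n : ℕ) :
    iteratedFDeriv ℝ n (fun x => z fun _ => x) 0 =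
      (Pi.single j (j.factorial • z) : (n : ℕ) → E [×n]→L[ℝ] F) n := by
  set p : FormalMultilinearSeries ℝ E F := (Pi.single j z : (n : ℕ) → E [×n]→L[ℝ] F)
  have hpj : p j = z := Pi.single_eq_same _ _
  have hpn : ∀ n, n ≠ j → p n = 0 := fun n hn => Pi.single_eq_of_ne hn _
  have hp : HasFPowerSeriesOnBall (fun x => z fun _ => x) p 0 ⊤ := by
    refine ⟨?_, ENNReal.zero_lt_top, fun {y} _ => ?_⟩
    · rw [p.radius_eq_top_of_forall_image_add_eq_zero (j + 1) fun n => hpn _ (by lia)]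
    · have := hasSum_single (f := fun n => p n fun _ => y) j fun n hn => by rw [hpn n hn]; rfl
      simpa only [hpj, zero_add] using this
  ext1 v
  rw [hp.iteratedFDeriv_eq_sum_of_completeSpace]
  rcases eq_or_ne n j with rfl | hn
  · rw [hpj, Pi.single_eq_same, ← symmetrize_apply, hz.symmetrize_apply, Fintype.card_fin,
      smul_apply]
  · simp [hpn n hn, hn]

/-- Each derivative of order at most `k` vanishes at the origin, hence is controlled by the next
one along the segment to the origin. -/
theorem norm_iteratedFDeriv_le_mul_norm_pow {f : E → F} {k : ℕ} (hf : ContDiff ℝ (k + 1) f)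
    (h0 : ∀ j ≤ k, iteratedFDeriv ℝ j f 0 = 0) {r C : ℝ}
    (hC : ∀ x, ‖x‖ ≤ r → ‖iteratedFDeriv ℝ (k + 1) f x‖ ≤ C) {j : ℕ} (hj : j ≤ k + 1) :
    ∀ x, ‖x‖ ≤ r → ‖iteratedFDeriv ℝ j f x‖ ≤ C * ‖x‖ ^ (k + 1 - j) := by
  induction hj using Nat.decreasingInduction with
  | self => simpa using hC
  | of_succ j hj ih =>
    intro x hx
    have hC0 : 0 ≤ C := (norm_nonneg _).trans (hC x hx)
    have hd : Differentiable ℝ (iteratedFDeriv ℝ j f) :=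
      hf.differentiable_iteratedFDeriv (by exact_mod_cast hj)
    have hbound : ∀ y ∈ Metric.closedBall (0 : E) ‖x‖,
        ‖fderiv ℝ (iteratedFDeriv ℝ j f) y‖ ≤ C * ‖x‖ ^ (k + 1 - (j + 1)) := fun y hy => by
      have hy : ‖y‖ ≤ ‖x‖ := mem_closedBall_zero_iff.1 hy
      rw [norm_fderiv_iteratedFDeriv]
      exact (ih y (hy.trans hx)).trans (by gcongr)
    have hmean := (convex_closedBall (0 : E) ‖x‖).norm_image_sub_le_of_norm_fderiv_le
      (fun y _ => hd y) hbound (Metric.mem_closedBall_self (norm_nonneg x))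
      (mem_closedBall_zero_iff.2 le_rfl)
    rw [h0 j (by lia), sub_zero, sub_zero, mul_assoc, ← pow_succ] at hmean
    rwa [show k + 1 - j = k + 1 - (j + 1) + 1 by lia]

theorem exists_norm_iteratedFDeriv_le {f : E → F} {k : ℕ} (hf : ContDiff ℝ k f)
    (hs : HasCompactSupport f) : ∃ M : ℝ, ∀ i ≤ k, ∀ x, ‖iteratedFDeriv ℝ i f x‖ ≤ M := by
  have h : ∀ i, ∃ M : ℝ, i ≤ k → ∀ x, ‖iteratedFDeriv ℝ i f x‖ ≤ M := fun i => by
    by_cases hi : i ≤ k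
    · obtain ⟨M, hM⟩ := (hs.iteratedFDeriv i).exists_bound_of_continuous
        (hf.continuous_iteratedFDeriv (by exact_mod_cast hi))
      exact ⟨M, fun _ => hM⟩
    · exact ⟨0, fun hi' => (hi hi').elim⟩
  choose M hM using h
  exact ⟨(Finset.range (k + 1)).sup' ⟨0, by simp⟩ M, fun i hi x =>
    (hM i hi x).trans (Finset.le_sup' M (Finset.mem_range.2 (by lia)))⟩

/-- The derivatives of `χ (x / ε)` grow like powers of `1 / ε`, which is compensated by the decay
of the derivatives of `h`, up to a spare factor `ε`. -/
theorem norm_iteratedFDeriv_dilation_smul_le {χ : E → ℝ} {h : E → F} {k : ℕ}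
    (hχ : ContDiff ℝ k χ) (hh : ContDiff ℝ k h) {M C ε : ℝ} (hε : 0 < ε) (hε1 : ε ≤ 1)
    (hM : ∀ i ≤ k, ∀ y, ‖iteratedFDeriv ℝ i χ y‖ ≤ M) {x : E}
    (hC : ∀ j ≤ k, ‖iteratedFDeriv ℝ j h x‖ ≤ C * ε ^ (k + 1 - j)) {n : ℕ} (hn : n ≤ k) :
    ‖iteratedFDeriv ℝ n (fun y => χ (ε⁻¹ • y) • h y) x‖ ≤ 2 ^ k * (M * C * ε) := by
  have hM0 : 0 ≤ M := (norm_nonneg _).trans (hM 0 k.zero_le 0)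
  have hC0 : 0 ≤ C := nonneg_of_mul_nonneg_left ((norm_nonneg _).trans (hC 0 k.zero_le))
    (by positivity)
  have hdilation : ∀ i ≤ k, ‖iteratedFDeriv ℝ i (fun y => χ (ε⁻¹ • y)) x‖ ≤ ε⁻¹ ^ i * M :=
    fun i hi => by
      rw [iteratedFDeriv_comp_const_smul _ (hχ.of_le (by exact_mod_cast hi)), norm_smul, norm_pow,
        norm_inv, Real.norm_of_nonneg hε.le]
      gcongr
      exact hM i hi _
  have hpow : ∀ i ≤ n, ε⁻¹ ^ i * ε ^ (k + 1 - (n - i)) ≤ ε := fun i hi => by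
    rw [show k + 1 - (n - i) = i + (k - n) + 1 by lia, pow_succ, pow_add, inv_pow]
    field_simp
    exact pow_le_one₀ hε.le hε1
  calc _ ≤ ∑ i ∈ Finset.range (n + 1), (n.choose i : ℝ) *
        ‖iteratedFDeriv ℝ i (fun y => χ (ε⁻¹ • y)) x‖ * ‖iteratedFDeriv ℝ (n - i) h x‖ :=
        norm_iteratedFDeriv_smul_le (hχ.comp (contDiff_id.const_smul ε⁻¹)) hh x
          (by exact_mod_cast hn)
    _ ≤ ∑ i ∈ Finset.range (n + 1), (n.choose i : ℝ) * (M * C * ε) := by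
        refine Finset.sum_le_sum fun i hi => ?_
        have hi : i ≤ n := Nat.lt_succ_iff.1 (Finset.mem_range.1 hi)
        rw [mul_assoc]
        refine mul_le_mul_of_nonneg_left ?_ (Nat.cast_nonneg _)
        calc _ ≤ (ε⁻¹ ^ i * M) * (C * ε ^ (k + 1 - (n - i))) :=
              mul_le_mul (hdilation i (hi.trans hn)) (hC _ (by lia)) (norm_nonneg _)
                (by positivity)
          _ = M * C * (ε⁻¹ ^ i * ε ^ (k + 1 - (n - i))) := by ring
          _ ≤ M * C * ε := by gcongr; exact hpow i hi
    _ = 2 ^ n * (M * C * ε) := by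
        rw [← Finset.sum_mul, ← Nat.cast_sum, Nat.sum_range_choose, Nat.cast_pow, Nat.cast_ofNat]
    _ ≤ 2 ^ k * (M * C * ε) := by gcongr; exact one_le_two

theorem exists_germ_eq_norm_iteratedFDeriv_le [FiniteDimensional ℝ E] {h : E → F}
    (hh : ContDiff ℝ ∞ h) {k : ℕ} (h0 : ∀ j ≤ k, iteratedFDeriv ℝ j h 0 = 0) {δ : ℝ} (hδ : 0 < δ) :
    ∃ g : E → F, ContDiff ℝ ∞ g ∧ g =ᶠ[𝓝 0] h ∧ ∀ j ≤ k, ∀ x, ‖iteratedFDeriv ℝ j g x‖ ≤ δ := by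
  have hle : ∀ n : ℕ, (n : WithTop ℕ∞) ≤ ∞ := fun n => by exact_mod_cast le_top
  let χ : ContDiffBump (0 : E) := ⟨2⁻¹, 1, by norm_num, by norm_num⟩
  obtain ⟨M, hM⟩ := exists_norm_iteratedFDeriv_le (k := k) χ.contDiff χ.hasCompactSupport
  obtain ⟨C, hC⟩ := (isCompact_closedBall (0 : E) 1).exists_bound_of_continuousOn
    (hh.continuous_iteratedFDeriv (hle (k + 1))).continuousOn
  have hsmall : Tendsto (fun ε : ℝ => 2 ^ k * (M * C * ε)) (𝓝[>] 0) (𝓝 0) :=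
    tendsto_nhdsWithin_of_tendsto_nhds <| Continuous.tendsto' (by fun_prop) _ _ (by simp)
  obtain ⟨ε, hε, hε1, hεδ⟩ : ∃ ε : ℝ, 0 < ε ∧ ε ≤ 1 ∧ 2 ^ k * (M * C * ε) < δ :=
    (eventually_mem_nhdsWithin.and
      ((tendsto_nhdsWithin_of_tendsto_nhds tendsto_id).eventually_le_const one_pos |>.and
        (hsmall.eventually_lt_const hδ))).exists
  have hχ : ContDiff ℝ ∞ fun x : E => χ (ε⁻¹ • x) := χ.contDiff.comp (contDiff_id.const_smul ε⁻¹)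
  refine ⟨fun x => χ (ε⁻¹ • x) • h x, hχ.smul hh, ?_, fun n hn x => ?_⟩
  · have : Tendsto (fun x : E => ε⁻¹ • x) (𝓝 0) (𝓝 0) :=
      (continuous_const_smul ε⁻¹).tendsto' _ _ (smul_zero _)
    filter_upwards [this.eventually χ.eventuallyEq_one] with x hx
    rw [hx, Pi.one_apply, one_smul]
  · by_cases hx : ‖x‖ ≤ ε
    · refine (norm_iteratedFDeriv_dilation_smul_le χ.contDiff (hh.of_le (hle k)) hε hε1 hM
        (fun j hj => ?_) hn).trans hεδ.le
      have hx1 : ‖x‖ ≤ 1 := hx.trans hε1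
      have hC0 : 0 ≤ C := (norm_nonneg _).trans (hC x (mem_closedBall_zero_iff.2 hx1))
      exact (norm_iteratedFDeriv_le_mul_norm_pow (hh.of_le (by exact_mod_cast hle (k + 1))) h0
        (fun y hy => hC y (mem_closedBall_zero_iff.2 hy)) (by lia) x hx1).trans (by gcongr)
    · have hsupp : Function.support (fun x => χ (ε⁻¹ • x) • h x) ⊆ Metric.closedBall 0 ε := by
        intro y hy
        have hy : ε⁻¹ • y ∈ Function.support χ := fun h0 => hy (by simp only [h0, zero_smul])
        rw [χ.support_eq, mem_ball_zero_iff, norm_smul, norm_inv, Real.norm_of_nonneg hε.le,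
          inv_mul_lt_iff₀ hε] at hy
        simpa [χ] using hy.le
      have hx' : x ∉ Function.support (iteratedFDeriv ℝ n fun x => χ (ε⁻¹ • x) • h x) := fun hx' =>
        hx <| mem_closedBall_zero_iff.1 <| closure_minimal hsupp Metric.isClosed_closedBall <|
          support_iteratedFDeriv_subset n hx'
      rw [Function.notMem_support.1 hx', norm_zero]
      exact hδ.le

end Calculus

theorem contDiff_multilinear {ι : Type*} [Fintype ι] {E : ι → Type*} {F : Type*}
    [∀ i, NormedAddCommGroup (E i)] [∀ i, NormedSpace ℝ (E i)] [∀ i, FiniteDimensional ℝ (E i)]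
    [NormedAddCommGroup F] [NormedSpace ℝ F] {n : WithTop ℕ∞} (t : MultilinearMap ℝ E F) :
    ContDiff ℝ n t := by
  classical
  let b := fun i => Module.finBasis ℝ (E i)
  have h : (t : (∀ i, E i) → F) = fun w => ∑ r : ∀ i, Fin (Module.finrank ℝ (E i)),
      (∏ i, (b i).coord (r i) (w i)) • t fun i => b i (r i) := by
    funext w
    conv_lhs => rw [← funext fun i => (b i).sum_repr (w i)]
    simp only [t.map_sum, t.map_smul_univ, Module.Basis.coord_apply]
  rw [h]
  refine ContDiff.sum fun r _ => ContDiff.smul (contDiff_prod fun i _ => ?_) contDiff_const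
  exact ((b i).coord (r i)).toContinuousLinearMap.contDiff.comp
    (ContinuousLinearMap.proj (R := ℝ) (φ := E) i).contDiff

instance finiteDimensional_continuousMultilinearMap {ι : Type*} [Finite ι] {E : ι → Type*}
    {F : Type*} [∀ i, NormedAddCommGroup (E i)] [∀ i, NormedSpace ℝ (E i)]
    [∀ i, FiniteDimensional ℝ (E i)] [NormedAddCommGroup F] [NormedSpace ℝ F]
    [FiniteDimensional ℝ F] : FiniteDimensional ℝ (ContinuousMultilinearMap ℝ E F) :=
  .of_injective (ContinuousMultilinearMap.toMultilinearMapLinear (R' := ℝ) (A := ℝ))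
    ContinuousMultilinearMap.toMultilinearMap_injective

/-! ### Continuous families of smooth maps -/

/-- A family of smooth maps on `E` that depends continuously on a parameter, in the sense that all
derivatives are jointly continuous in the parameter and the point. -/
structure ContDiffFamily {X E F : Type*} [TopologicalSpace X] [NormedAddCommGroup E]
    [NormedSpace ℝ E] [NormedAddCommGroup F] [NormedSpace ℝ F] (f : X → E → F) : Prop where
  contDiff : ∀ p, ContDiff ℝ ∞ (f p)
  continuous_iteratedFDeriv : ∀ n, Continuous fun q : X × E => iteratedFDeriv ℝ n (f q.1) q.2

namespace ContDiffFamily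

variable {X E F : Type*} [TopologicalSpace X] [NormedAddCommGroup E] [NormedSpace ℝ E]
  [NormedAddCommGroup F] [NormedSpace ℝ F] {f : X → E → F}

theorem comp_left {G : Type*} [NormedAddCommGroup G] [NormedSpace ℝ G] (hf : ContDiffFamily f)
    {g : F → G} (hg : ContDiff ℝ ∞ g) : ContDiffFamily fun p x => g (f p x) := by
  have hle : ∀ n : ℕ, (n : WithTop ℕ∞) ≤ ∞ := fun n => by exact_mod_cast le_top
  refine ⟨fun p => hg.comp (hf.contDiff p), fun n => ?_⟩
  have faaDiBruno : ∀ q : X × E, iteratedFDeriv ℝ n (fun x => g (f q.1 x)) q.2 =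
      ∑ c : OrderedFinpartition n, c.compAlongOrderedFinpartitionL ℝ E F G
        (iteratedFDeriv ℝ c.length g (f q.1 q.2))
        fun i => iteratedFDeriv ℝ (c.partSize i) (f q.1) q.2 := fun q =>
    iteratedFDeriv_comp hg.contDiffAt (hf.contDiff q.1).contDiffAt (hle n)
  have hf0 : Continuous fun q : X × E => f q.1 q.2 :=
    (continuousMultilinearCurryFin0 ℝ E F).continuous.comp (hf.continuous_iteratedFDeriv 0)
  simp only [faaDiBruno]
  exact continuous_finsetSum _ fun c _ => .eval
    ((ContinuousLinearMap.continuous _).comp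
      ((hg.continuous_iteratedFDeriv (hle c.length)).comp hf0))
    (continuous_pi fun i => hf.continuous_iteratedFDeriv (c.partSize i))

theorem pi {ι : Type*} [Fintype ι] {F : ι → Type*} [∀ i, NormedAddCommGroup (F i)]
    [∀ i, NormedSpace ℝ (F i)] {f : ∀ i, X → E → F i} (hf : ∀ i, ContDiffFamily (f i)) :
    ContDiffFamily fun p x i => f i p x := by
  refine ⟨fun p => contDiff_pi.2 fun i => (hf i).contDiff p, fun n => ?_⟩
  have h : ∀ q : X × E, iteratedFDeriv ℝ n (fun x i => f i q.1 x) q.2 =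
      ContinuousMultilinearMap.pi fun i => iteratedFDeriv ℝ n (f i q.1) q.2 := fun q => by
    ext v i
    have hpi : ContDiff ℝ ∞ fun x i => f i q.1 x := contDiff_pi.2 fun i => (hf i).contDiff q.1
    exact DFunLike.congr_fun (ContinuousLinearMap.iteratedFDeriv_comp_left (.proj (φ := F) i)
      hpi.contDiffAt (x := q.2) (i := n) (by exact_mod_cast le_top)).symm v
  simp only [h]
  exact (ContinuousMultilinearMap.piₗᵢ ℝ (fun _ : Fin n => E)).continuous.comp
    (continuous_pi fun i => (hf i).continuous_iteratedFDeriv n)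

theorem fderiv (hf : ContDiffFamily f) : ContDiffFamily fun p => fderiv ℝ (f p) := by
  refine ⟨fun p => (hf.contDiff p).fderiv_right (by exact_mod_cast le_top), fun n => ?_⟩
  have h : ∀ q : X × E, iteratedFDeriv ℝ n (_root_.fderiv ℝ (f q.1)) q.2 =
      continuousMultilinearCurryRightEquiv' ℝ n E F (iteratedFDeriv ℝ (n + 1) (f q.1) q.2) :=
    fun q => by rw [iteratedFDeriv_succ_eq_comp_right]; simp
  simp only [h]
  exact (LinearIsometryEquiv.continuous _).comp (hf.continuous_iteratedFDeriv (n + 1))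

theorem iteratedFDeriv (hf : ContDiffFamily f) (j : ℕ) :
    ContDiffFamily fun p => iteratedFDeriv ℝ j (f p) := by
  induction j with
  | zero => exact hf.comp_left (continuousMultilinearCurryFin0 ℝ E F).symm.contDiff
  | succ j ih =>
    simp only [iteratedFDeriv_succ_eq_comp_left]
    exact ih.fderiv.comp_left (LinearIsometryEquiv.contDiff _)

end ContDiffFamily

/-! ### Vector fields -/

section VectorFields

variable {d : ℕ}

theorem VF.ext {f g : VF d} (h : ∀ x, f x = g x) : f = g := Subtype.ext (funext h)

theorem VF.continuous_iff_contDiffFamily {X : Type*} [TopologicalSpace X] {F : X → VF d} :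
    Continuous F ↔ ContDiffFamily fun p => (F p : Pt d → Pt d) := by
  have h : Continuous F ↔ ∀ k, Continuous fun p => VF.iterD k (F p) := by
    simp only [continuous_iInf_rng, continuous_induced_rng, Function.comp_def]
  refine h.trans ⟨fun hF => ⟨fun p => (F p).contDiff, fun k => ?_⟩, fun hF k => ?_⟩
  · exact ((hF k).comp continuous_fst).eval continuous_snd
  · exact ContinuousMap.continuous_of_continuous_uncurry _ (hF.continuous_iteratedFDeriv k)

/-- Evaluation of vector fields at a point. -/
def VF.eval (x : Pt d) : VF d →L[ℝ] Pt d where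
  toFun f := f x
  map_add' _ _ := rfl
  map_smul' _ _ := rfl
  cont := (continuousMultilinearCurryFin0 ℝ (Pt d) (Pt d)).continuous.comp
    ((continuous_iff_contDiffFamily.1 continuous_id).continuous_iteratedFDeriv 0 |>.comp
      (Continuous.prodMk_left x))

theorem VF.eval_apply (x : Pt d) (f : VF d) : VF.eval x f = f x := rfl

/-- The action of an affine transformation on vector fields, as a linear map. -/
def affActₗ (A : Pt d ≃L[ℝ] Pt d) (b : Pt d) : VF d →ₗ[ℝ] VF d where
  toFun := affAct A b
  map_add' f g := VF.ext fun x => map_add A (f (A.symm (x - b))) (g (A.symm (x - b)))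
  map_smul' c f := VF.ext fun x => map_smul A c (f (A.symm (x - b)))

theorem affActₗ_apply (A : Pt d ≃L[ℝ] Pt d) (b : Pt d) (f : VF d) : affActₗ A b f = affAct A b f :=
  rfl

/-- The value of `L` at a point depends only on the germs of its arguments there. -/
def DependsOnGerms {ι : Type*} (L : (ι → VF d) → VF d) : Prop :=
  ∀ (f g : ι → VF d) (x : Pt d), (∀ i, (f i : Pt d → Pt d) =ᶠ[𝓝 x] g i) → L f x = L g x

/-- Equivariance of a map of several vector fields under `G = H ⋉ ℝ^d`. -/
def IsEquivariantMulti {ι : Type*} (H : Subgroup (Pt d ≃L[ℝ] Pt d)) (L : (ι → VF d) → VF d) :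
    Prop :=
  ∀ A ∈ H, ∀ (b : Pt d) (f : ι → VF d), L (fun i => affAct A b (f i)) = affAct A b (L f)

end VectorFields

/-! ### Derivatives of smooth maps between vector fields -/

namespace HasDerivatives

variable {d : ℕ} {φ φ' : VF d → VF d} {D D' : (k : ℕ) → VF d → (Fin k → VF d) → VF d}

theorem hasDerivAt (h : HasDerivatives φ D) (k : ℕ) (σ τ : VF d) (v : Fin k → VF d) (x : Pt d)
    (r : ℝ) :
    HasDerivAt (fun r : ℝ => D k (σ + r • τ) v x) (D (k + 1) (σ + r • τ) (Fin.cons τ v) x) r := by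
  rw [hasDerivAt_iff_tendsto_slope_zero]
  refine (((VF.eval x).continuous.tendsto _).comp (h.succ k (σ + r • τ) τ v)).congr fun ε => ?_
  rw [Function.comp_apply, map_smul, map_sub, add_smul, add_assoc]
  rfl

theorem cons_eq_of_hasDerivAt (h : HasDerivatives φ D) {k : ℕ} {σ τ : VF d} {v : Fin k → VF d}
    {x y : Pt d} (hy : HasDerivAt (fun r : ℝ => D k (σ + r • τ) v x) y 0) :
    D (k + 1) σ (Fin.cons τ v) x = y := by
  simpa only [zero_smul, add_zero] using (h.hasDerivAt k σ τ v x 0).unique hy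

/-- The derivative along `τ + τ'` is the derivative along the diagonal of
`(r, s) ↦ D k (σ + r • τ + s • τ') v x`, the sum of the two partial derivatives. -/
theorem map_cons_add (h : HasDerivatives φ D) (k : ℕ) (σ τ τ' : VF d) (v : Fin k → VF d) :
    D (k + 1) σ (Fin.cons (τ + τ') v) =
      D (k + 1) σ (Fin.cons τ v) + D (k + 1) σ (Fin.cons τ' v) := by
  refine VF.ext fun x => h.cons_eq_of_hasDerivAt ?_
  have hc : ∀ ρ : VF d, Continuous fun p : ℝ × ℝ =>
      D (k + 1) (σ + p.1 • τ + p.2 • τ') (Fin.cons ρ v) x := fun ρ =>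
    (VF.eval x).continuous.comp ((h.continuous (k + 1)).comp
      (.prodMk (by fun_prop) continuous_const))
  have hdiag := hasDerivAt_diagonal (f := fun r s => D k (σ + r • τ + s • τ') v x)
    (fun r s => by simpa only [add_right_comm σ] using h.hasDerivAt k (σ + s • τ') τ v x r)
    (fun r s => h.hasDerivAt k (σ + r • τ) τ' v x s) (hc τ) (hc τ') 0
  simpa only [smul_add, ← add_assoc, zero_smul, add_zero] using! hdiag

theorem map_cons_smul (h : HasDerivatives φ D) (k : ℕ) (σ τ : VF d) (c : ℝ) (v : Fin k → VF d) :
    D (k + 1) σ (Fin.cons (c • τ) v) = c • D (k + 1) σ (Fin.cons τ v) := by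
  refine VF.ext fun x => h.cons_eq_of_hasDerivAt ?_
  have hscale := (h.hasDerivAt k σ τ v x (0 * c)).scomp 0 ((hasDerivAt_id (0 : ℝ)).mul_const c)
  simpa only [Function.comp_def, id, mul_smul, zero_smul, smul_zero, add_zero, one_mul, one_smul]
    using! hscale

theorem cons_congr (h : HasDerivatives φ D) (h' : HasDerivatives φ' D') {k : ℕ} {σ σ' τ τ' : VF d}
    {v v' : Fin k → VF d} {x x' : Pt d} {A : Pt d →L[ℝ] Pt d}
    (H : ∀ ε : ℝ, D k (σ + ε • τ) v x = A (D' k (σ' + ε • τ') v' x')) :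
    D (k + 1) σ (Fin.cons τ v) x = A (D' (k + 1) σ' (Fin.cons τ' v') x') := by
  refine h.cons_eq_of_hasDerivAt ?_
  simpa only [Function.comp_def, ← H, zero_smul, add_zero] using!
    A.hasFDerivAt.comp_hasDerivAt (0 : ℝ) (h'.hasDerivAt k σ' τ' v' x' 0)

theorem unique (h : HasDerivatives φ D) (h' : HasDerivatives φ D') : D = D' := by
  funext k
  induction k with
  | zero => funext σ v; rw [h.zero, h'.zero]
  | succ k ih =>
    funext σ v
    refine VF.ext fun x => ?_
    rw [← Fin.cons_self_tail v]
    exact h.cons_congr h' (A := .id ℝ _) fun ε => by rw [ih]; rfl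

theorem map_update_add (h : HasDerivatives φ D) (k : ℕ) (σ : VF d) (v : Fin k → VF d) (i : Fin k)
    (a b : VF d) : D k σ (Function.update v i (a + b)) =
      D k σ (Function.update v i a) + D k σ (Function.update v i b) := by
  induction k generalizing σ with
  | zero => exact i.elim0
  | succ k ih =>
    induction v using Fin.consCases with | _ τ v
    induction i using Fin.cases with
    | zero => simp only [Fin.update_cons_zero, h.map_cons_add]
    | succ i =>
      simp only [← Fin.cons_update]
      refine VF.ext fun x => h.cons_eq_of_hasDerivAt ?_
      simpa only [ih, zero_smul, add_zero] using!
        (h.hasDerivAt k σ τ (Function.update v i a) x 0).add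
          (h.hasDerivAt k σ τ (Function.update v i b) x 0)

theorem map_update_smul (h : HasDerivatives φ D) (k : ℕ) (σ : VF d) (v : Fin k → VF d) (i : Fin k)
    (c : ℝ) (a : VF d) :
    D k σ (Function.update v i (c • a)) = c • D k σ (Function.update v i a) := by
  induction k generalizing σ with
  | zero => exact i.elim0
  | succ k ih =>
    induction v using Fin.consCases with | _ τ v
    induction i using Fin.cases with
    | zero => simp only [Fin.update_cons_zero, h.map_cons_smul]
    | succ i =>
      simp only [← Fin.cons_update]
      exact VF.ext fun x => h.cons_congr h (A := c • .id ℝ _) (x' := x) fun ε => by rw [ih]; rfl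

/-- The `k`-th derivative at `σ` as a continuous multilinear map. -/
def toMultilinear (h : HasDerivatives φ D) (k : ℕ) (σ : VF d) :
    ContinuousMultilinearMap ℝ (fun _ : Fin k => VF d) (VF d) where
  toMultilinearMap := MultilinearMap.mk' (D k σ) (h.map_update_add k σ) (h.map_update_smul k σ)
  cont := (h.continuous k).comp (Continuous.prodMk_right σ)

theorem congr_of_germ (h : HasDerivatives φ D) (hφ : IsLocal φ) (k : ℕ) {σ σ' : VF d}
    {v v' : Fin k → VF d} {x : Pt d} (hσ : (σ : Pt d → Pt d) =ᶠ[𝓝 x] σ')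
    (hv : ∀ i, (v i : Pt d → Pt d) =ᶠ[𝓝 x] v' i) : D k σ v x = D k σ' v' x := by
  induction k generalizing σ σ' with
  | zero => rw [h.zero, h.zero]; exact hφ.2 _ _ _ hσ
  | succ k ih =>
    rw [← Fin.cons_self_tail v, ← Fin.cons_self_tail v']
    refine h.cons_congr h (A := .id ℝ _) fun ε => ih ?_ fun i => hv i.succ
    exact hσ.add ((hv 0).const_smul ε)

theorem affAct_apply (h : HasDerivatives φ D) {A : Pt d ≃L[ℝ] Pt d} {b : Pt d}
    (hφ : ∀ f, φ (affAct A b f) = affAct A b (φ f)) (k : ℕ) (σ : VF d) (v : Fin k → VF d) :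
    D k (affAct A b σ) (fun i => affAct A b (v i)) = affAct A b (D k σ v) := by
  induction k generalizing σ with
  | zero => rw [h.zero, h.zero, hφ]
  | succ k ih =>
    refine VF.ext fun x => ?_
    rw [← Fin.cons_self_tail v, ← Fin.cons_self_tail fun i => affAct A b _]
    refine h.cons_congr h (A := (A : Pt d →L[ℝ] Pt d)) (x' := A.symm (x - b)) fun ε => ?_
    simp only [← affActₗ_apply, Fin.cons_zero, ← map_smul, ← map_add]
    exact congrFun (congrArg Subtype.val (ih (σ + ε • v 0) fun i => v i.succ)) x

end HasDerivatives

/-! ### Homogeneous polynomials and Taylor terms -/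

theorem extend_fin_cons {ι M : Type*} {k : ℕ} (e : Fin (k + 1) ↪ ι) [DecidableEq ι] (a : M)
    (v : Fin k → M) (w : ι → M) : Function.extend e (Fin.cons a v) w =
      Function.update (Function.extend (e ∘ Fin.succ) v w) (e 0) a := by
  ext i
  by_cases hi : ∃ j, e j = i
  · obtain ⟨j, rfl⟩ := hi
    rw [e.injective.extend_apply]
    induction j using Fin.cases with
    | zero => simp
    | succ j =>
      rw [Function.update_of_ne (e.injective.ne j.succ_ne_zero),
        ← Function.comp_apply (f := e) (g := Fin.succ),
        (e.injective.comp (Fin.succ_injective k)).extend_apply, Fin.cons_succ]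
  · rw [Function.extend_apply' _ _ _ hi, Function.update_of_ne fun h => hi ⟨0, h.symm⟩,
      Function.extend_apply' _ _ _ fun ⟨j, hj⟩ => hi ⟨j.succ, hj⟩]

theorem sum_embedding_fin_succ {ι N : Type*} [Fintype ι] [AddCommMonoid N] {k : ℕ}
    (F : (Fin k ↪ ι) → ι → N) (hF : ∀ (e : Fin k ↪ ι) (i : ι), i ∈ Set.range e → F e i = 0) :
    ∑ e : Fin (k + 1) ↪ ι, F ((Fin.succEmb k).trans e) (e 0) = ∑ e : Fin k ↪ ι, ∑ i, F e i := by
  classical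
  let F' (p : Σ e : Fin k ↪ ι, {i // i ∉ Set.range e}) : N := F p.1 p.2
  refine ((Equiv.embeddingFinSucc k ι).sum_comp F').trans ((Fintype.sum_sigma F').trans ?_)
  refine Finset.sum_congr rfl fun e _ => ?_
  rw [← Fintype.sum_subtype_add_sum_subtype (· ∈ Set.range e) (F e),
    Finset.sum_eq_zero fun (i : {i // i ∈ Set.range e}) _ => hF e i i.2, zero_add]

variable {d m : ℕ}

theorem hasDerivatives_homPoly (L : ContinuousMultilinearMap ℝ (fun _ : Fin m => VF d) (VF d)) :
    HasDerivatives (homPoly L)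
      fun k σ v => ∑ e : Fin k ↪ Fin m, L (Function.extend e v fun _ => σ) where
  zero σ v := by
    rw [Fintype.sum_unique]
    congr 1
    exact funext fun i => Function.extend_apply' _ _ _ fun ⟨j, _⟩ => j.elim0
  succ k σ τ v := by
    have slopes := tendsto_finsetSum Finset.univ fun (e : Fin k ↪ Fin m) _ =>
      tendsto_slope_multilinear L (Function.extend e v fun _ => σ)
        (Function.extend e 0 fun _ => τ)
    rw [← sum_embedding_fin_succ fun e i => L (Function.update (Function.extend e v fun _ => σ) i
      (Function.extend e 0 (fun _ => τ) i))] at slopes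
    · convert! slopes using 2
      · rw [← Finset.sum_sub_distrib, Finset.smul_sum]
        refine Finset.sum_congr rfl fun e _ => ?_
        rw [← Function.extend_smul, ← Function.extend_add, smul_zero, add_zero]
        rfl
      · refine Finset.sum_congr rfl fun e _ => ?_
        rw [extend_fin_cons, Function.extend_apply' _ _ (e 0) fun ⟨j, hj⟩ =>
          j.succ_ne_zero (e.injective hj)]
        rfl
    · rintro e _ ⟨j, rfl⟩
      rw [e.injective.extend_apply]
      exact L.map_update_zero _ _
  continuous k := by
    refine continuous_finsetSum _ fun e _ => L.cont.comp (continuous_pi fun i => ?_)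
    by_cases hi : ∃ j, e j = i
    · obtain ⟨j, rfl⟩ := hi
      simp only [e.injective.extend_apply]
      fun_prop
    · simp only [Function.extend_apply' _ _ _ hi]
      exact continuous_fst

theorem IsSmoothWithTaylorTerm.unique {φ : VF d → VF d} {T T' : (Fin m → VF d) → VF d}
    (h : IsSmoothWithTaylorTerm m φ T) (h' : IsSmoothWithTaylorTerm m φ T') : T = T' := by
  obtain ⟨D, hD, rfl⟩ := h
  obtain ⟨D', hD', rfl⟩ := h'
  rw [hD.unique hD']

theorem isSmoothWithTaylorTerm_homPoly
    (L : ContinuousMultilinearMap ℝ (fun _ : Fin m => VF d) (VF d)) :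
    IsSmoothWithTaylorTerm m (homPoly L) (symmetrize L) := by
  refine ⟨_, hasDerivatives_homPoly L, funext fun v => ?_⟩
  rw [symmetrize_apply, ← Equiv.sum_comp (Equiv.inv (Equiv.Perm (Fin m))),
    ← Equiv.sum_comp (Equiv.embeddingEquivOfFinite (Fin m))]
  congr! 2 with e
  ext1 i
  obtain ⟨j, rfl⟩ := e.equivOfFiniteSelfEmbedding.surjective i
  exact (congrArg v (e.equivOfFiniteSelfEmbedding.symm_apply_apply j)).trans
    (e.injective.extend_apply v _ j).symm

theorem homPoly_symmetrize (L : ContinuousMultilinearMap ℝ (fun _ : Fin m => VF d) (VF d)) :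
    homPoly (symmetrize L) = m.factorial • homPoly L := by
  ext1 f
  simp only [homPoly, symmetrize_apply, Pi.smul_apply, Finset.sum_const, Finset.card_univ,
    Fintype.card_perm, Fintype.card_fin]

theorem IsSymm.eq_of_homPoly_eq
    {L L' : ContinuousMultilinearMap ℝ (fun _ : Fin m => VF d) (VF d)} (hL : IsSymm L)
    (hL' : IsSymm L') (h : homPoly L = homPoly L') : L = L' := by
  have hsymm := (isSmoothWithTaylorTerm_homPoly L).unique
    (h ▸ isSmoothWithTaylorTerm_homPoly L')
  ext1 v
  have hv := congrFun hsymm v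
  rw [hL.symmetrize_apply, hL'.symmetrize_apply, ← Nat.cast_smul_eq_nsmul ℝ,
    ← Nat.cast_smul_eq_nsmul ℝ] at hv
  exact smul_right_injective _ (Nat.cast_ne_zero.2 (Nat.factorial_ne_zero _)) hv

theorem DependsOnGerms.isLocalMulti (hm : 1 ≤ m)
    {L : ContinuousMultilinearMap ℝ (fun _ : Fin m => VF d) (VF d)} (hL : DependsOnGerms L) :
    IsLocalMulti L := by
  refine ⟨fun f => closure_minimal (fun x hx => ?_)
    (isClosed_iUnion_of_finite fun i => isClosed_tsupport _), hL⟩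
  contrapose! hx
  simp only [Set.mem_iUnion, not_exists, notMem_tsupport_iff_eventuallyEq] at hx
  rw [Function.notMem_support, hL f 0 x hx, L.map_coord_zero (⟨0, hm⟩ : Fin m) rfl]
  rfl

theorem symmetrize_mem_linLoc (hm : 1 ≤ m) {H : Subgroup (Pt d ≃L[ℝ] Pt d)}
    {L : ContinuousMultilinearMap ℝ (fun _ : Fin m => VF d) (VF d)} (hloc : DependsOnGerms L)
    (heq : IsEquivariantMulti H L) : symmetrize L ∈ linLoc H m := by
  refine ⟨isSymm_symmetrize L, DependsOnGerms.isLocalMulti hm fun _ _ _ h => ?_, fun A hA b _ => ?_⟩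
  · simp only [symmetrize_apply, ← VF.eval_apply, map_sum]
    exact Finset.sum_congr rfl fun σ _ => hloc _ _ _ fun i => h _
  · simp only [symmetrize_apply, ← affActₗ_apply, map_sum]
    exact Finset.sum_congr rfl fun σ _ => heq A hA b _

theorem IsLocalMulti.isLocal_homPoly {L : (Fin m → VF d) → VF d} (hL : IsLocalMulti L) :
    IsLocal (homPoly L) :=
  ⟨fun _ => (hL.1 _).trans (Set.iUnion_subset fun _ => subset_rfl),
    fun _ _ x h => hL.2 _ _ x fun _ => h⟩

theorem taylorTerms_eq_image (hm : 1 ≤ m) (H : Subgroup (Pt d ≃L[ℝ] Pt d)) :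
    taylorTerms H m =
      (fun L : ContinuousMultilinearMap ℝ (fun _ : Fin m => VF d) (VF d) => homPoly L) ''
        (linLoc H m : Set _) := by
  have hfact : (m.factorial : ℝ) ≠ 0 := by exact_mod_cast m.factorial_ne_zero
  ext p
  constructor
  · rintro ⟨φ, T, hloc, heq, ⟨D, hD, rfl⟩, rfl⟩
    have hsymm : symmetrize (hD.toMultilinear m 0) ∈ linLoc H m := by
      refine symmetrize_mem_linLoc hm (fun f g x h => hD.congr_of_germ hloc m .rfl h)
        fun A hA b f => ?_
      simpa only [← affActₗ_apply, map_zero] using! hD.affAct_apply (heq A hA b) m 0 f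
    refine ⟨(m.factorial : ℝ)⁻¹ • symmetrize (hD.toMultilinear m 0),
      Submodule.smul_mem _ _ hsymm, ?_⟩
    calc homPoly ((m.factorial : ℝ)⁻¹ • symmetrize (hD.toMultilinear m 0))
        = (m.factorial : ℝ)⁻¹ • m.factorial • homPoly (D m 0) :=
          congrArg ((m.factorial : ℝ)⁻¹ • ·) (homPoly_symmetrize (hD.toMultilinear m 0))
      _ = homPoly (D m 0) := by rw [← Nat.cast_smul_eq_nsmul ℝ, inv_smul_smul₀ hfact]
  · rintro ⟨L, hL, rfl⟩
    obtain ⟨-, hloc, heq⟩ := Submodule.smul_mem _ (m.factorial : ℝ)⁻¹ hL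
    refine ⟨_, _, hloc.isLocal_homPoly, fun A hA b f => heq A hA b _,
      isSmoothWithTaylorTerm_homPoly _, ?_⟩
    rw [homPoly_symmetrize, ← Nat.cast_smul_eq_nsmul ℝ]
    exact (smul_inv_smul₀ hfact (homPoly L)).symm

/-! ### Jets and polynomial vector fields -/

section Jets

variable {d : ℕ}

/-- The degree-`j` part of the jet at a point, as a linear map. -/
def jetAt (x : Pt d) (j : ℕ) : VF d →ₗ[ℝ] symJet d j where
  toFun f := ⟨iteratedFDeriv ℝ j f x, fun σ v => iteratedFDeriv_perm f.contDiff j σ x v⟩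
  map_add' f g := Subtype.ext (DFunLike.congr_fun ((VF.iterD j).map_add f g) x)
  map_smul' c f := Subtype.ext (DFunLike.congr_fun ((VF.iterD j).map_smul c f) x)

theorem coe_jetAt (x : Pt d) (j : ℕ) (f : VF d) :
    (jetAt x j f : Pt d [×j]→L[ℝ] Pt d) = iteratedFDeriv ℝ j f x := rfl

/-- The homogeneous polynomial vector field of degree `j` with prescribed `j`-th derivative at the
origin. -/
def homField (j : ℕ) : symJet d j →ₗ[ℝ] VF d where
  toFun z := ⟨fun x => (j.factorial : ℝ)⁻¹ • z.1 fun _ => x,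
    show ContDiff ℝ ∞ _ from (contDiff_diagonal z.1).const_smul (j.factorial : ℝ)⁻¹⟩
  map_add' z w := VF.ext fun x => smul_add (j.factorial : ℝ)⁻¹ (z.1 fun _ => x) (w.1 fun _ => x)
  map_smul' c z := VF.ext fun x => smul_comm (j.factorial : ℝ)⁻¹ c (z.1 fun _ => x)

theorem iteratedFDeriv_homField (j : ℕ) (z : symJet d j) (n : ℕ) :
    iteratedFDeriv ℝ n (homField j z) 0 =
      (Pi.single j z.1 : (n : ℕ) → Pt d [×n]→L[ℝ] Pt d) n := by
  change iteratedFDeriv ℝ n ((j.factorial : ℝ)⁻¹ • fun x => z.1 fun _ => x) 0 = _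
  rw [iteratedFDeriv_const_smul_apply (contDiff_diagonal z.1).contDiffAt,
    iteratedFDeriv_diagonal_zero z.2, ← Nat.cast_smul_eq_nsmul ℝ, ← Pi.smul_apply,
    ← Pi.single_smul, inv_smul_smul₀ (by positivity)]

theorem jetPart_homField_self (j : ℕ) (z : symJet d j) : jetPart j (homField j z) = z :=
  Subtype.ext ((iteratedFDeriv_homField j z j).trans (Pi.single_eq_same _ _))

theorem jetPart_homField_of_ne {j n : ℕ} (h : n ≠ j) (z : symJet d j) :
    jetPart n (homField j z) = 0 :=
  Subtype.ext ((iteratedFDeriv_homField j z n).trans (Pi.single_eq_of_ne h _))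

theorem jet_homField (k j : ℕ) (z : symJet d j) : jet k (homField j z) = jetSingle k j z := by
  funext n
  by_cases h : j < k + 1
  · rw [jetSingle, dif_pos h]
    rcases eq_or_ne n ⟨j, h⟩ with rfl | hn
    · rw [Pi.single_eq_same]
      exact jetPart_homField_self j z
    · rw [Pi.single_eq_of_ne hn]
      exact jetPart_homField_of_ne (fun e => hn (Fin.ext e)) z
  · rw [jetSingle, dif_neg h]
    exact jetPart_homField_of_ne (fun e : (n : ℕ) = j => h (e ▸ n.2)) z

/-- The polynomial vector field of degree at most `k` with prescribed `k`-jet at the origin. -/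
def jetField (k : ℕ) : Jet d k →ₗ[ℝ] VF d :=
  ∑ j : Fin (k + 1), homField (j : ℕ) ∘ₗ LinearMap.proj j

theorem jetField_apply (k : ℕ) (z : Jet d k) :
    jetField k z = ∑ j : Fin (k + 1), homField (j : ℕ) (z j) := by
  simp [jetField]

theorem jet_jetField (k : ℕ) (z : Jet d k) : jet k (jetField k z) = z := by
  funext j
  change jetAt 0 j (jetField k z) = z j
  rw [jetField_apply, map_sum, Finset.sum_eq_single j]
  · exact jetPart_homField_self (j : ℕ) (z j)
  · exact fun n _ hn => jetPart_homField_of_ne (fun e => hn (Fin.ext e.symm)) (z n)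
  · simp

theorem jet_sub (k : ℕ) (f g : VF d) : jet k (f - g) = jet k f - jet k g :=
  funext fun j => map_sub (jetAt 0 j) f g

end Jets

/-! ### Finite order of local multilinear maps -/

theorem exists_mem_of_norm_le_of_mem_nhds_zero {X F : Type*} [TopologicalSpace X]
    [SeminormedAddCommGroup F] {V : Set C(X, F)} (hV : V ∈ 𝓝 0) :
    ∃ δ : ℝ, 0 < δ ∧ ∀ g : C(X, F), (∀ x, ‖g x‖ ≤ δ) → g ∈ V := by
  obtain ⟨W, hW, hWV⟩ := UniformSpace.mem_nhds_iff.1 hV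
  obtain ⟨K, Z, -, hZ, hKZ⟩ := (ContinuousMap.mem_compactConvergence_entourage_iff W).1 hW
  obtain ⟨δ, hδ, hδZ⟩ := Metric.mem_uniformity_dist.1 hZ
  refine ⟨δ / 2, half_pos hδ, fun g hg => hWV (hKZ fun x _ => hδZ ?_)⟩
  rw [ContinuousMap.zero_apply, dist_zero_left]
  exact (hg x).trans_lt (half_lt_self hδ)

section FiniteOrder

variable {d : ℕ} {ι : Type*}

theorem VF.exists_mem_of_norm_iteratedFDeriv_le {U : Set (VF d)} (hU : U ∈ 𝓝 0) :
    ∃ (k : ℕ) (δ : ℝ), 0 < δ ∧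
      ∀ g : VF d, (∀ j ≤ k, ∀ x, ‖iteratedFDeriv ℝ j g x‖ ≤ δ) → g ∈ U := by
  have hnhds : 𝓝 (0 : VF d) = ⨅ k : ℕ, comap (VF.iterD k) (𝓝 0) := by
    rw [nhds_iInf]
    simp only [nhds_induced, map_zero]
  rw [hnhds] at hU
  refine Filter.iInf_sets_induct hU ⟨0, 1, one_pos, fun _ _ => trivial⟩ ?_
  rintro n _ _ ⟨V, hV, hVU⟩ ⟨k, δ, hδ, hk⟩
  obtain ⟨δ', hδ', hV'⟩ := exists_mem_of_norm_le_of_mem_nhds_zero hV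
  refine ⟨max n k, min δ' δ, lt_min hδ' hδ, fun g hg => ⟨hVU (hV' _ fun x => ?_), hk g ?_⟩⟩
  · exact (hg n (le_max_left _ _) x).trans (min_le_left _ _)
  · exact fun j hj x => (hg j (hj.trans (le_max_right _ _)) x).trans (min_le_right _ _)

/-- `L` has order at most `k` at the origin, in the form appropriate to multilinear maps: it
vanishes there as soon as one argument has vanishing `k`-jet. -/
def HasOrderLE (k : ℕ) (L : (ι → VF d) → VF d) : Prop :=
  ∀ f i, jet k (f i) = 0 → L f 0 = 0

variable {L : ContinuousMultilinearMap ℝ (fun _ : ι => VF d) (VF d)}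

/-- A germ with vanishing `k`-jet has arbitrarily `C^k`-small representatives. -/
theorem DependsOnGerms.exists_hasOrderLE [Finite ι] (hL : DependsOnGerms L) :
    ∃ k, HasOrderLE k L := by
  classical
  obtain ⟨U, hU, hLU⟩ :=
    exists_nhds_zero_map_eq_zero ((VF.eval (0 : Pt d)).compContinuousMultilinearMap L)
  obtain ⟨k, δ, hδ, hk⟩ := VF.exists_mem_of_norm_iteratedFDeriv_le hU
  refine ⟨k, fun f i hf => hLU f i fun c hc => ?_⟩
  have hflat : ∀ j ≤ k, iteratedFDeriv ℝ j (c • f i : VF d) 0 = 0 := fun j hj => by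
    have h : jetAt 0 j (f i) = 0 := congrFun hf ⟨j, Nat.lt_succ_of_le hj⟩
    rw [← coe_jetAt, map_smul, h, smul_zero, ZeroMemClass.coe_zero]
  obtain ⟨g, hgf, hgδ⟩ : ∃ g : VF d, (g : Pt d → Pt d) =ᶠ[𝓝 0] (c • f i : VF d) ∧
      ∀ j ≤ k, ∀ x, ‖iteratedFDeriv ℝ j g x‖ ≤ δ := by
    obtain ⟨g, hg, h⟩ := exists_germ_eq_norm_iteratedFDeriv_le (c • f i).contDiff hflat hδ
    exact ⟨⟨g, hg⟩, h⟩
  refine ⟨c⁻¹ • g, hL _ _ 0 fun j => ?_, ?_⟩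
  · rcases eq_or_ne j i with rfl | hj
    · rw [Function.update_self]
      filter_upwards [hgf] with x hx
      rw [VF.coe_smul, Pi.smul_apply, hx]
      exact inv_smul_smul₀ hc _
    · rw [Function.update_of_ne hj]
  · rw [smul_inv_smul₀ hc]
    exact hk g hgδ

/-- The multilinear function of `k`-jets at the origin induced by a multilinear map on vector
fields. -/
def jetForm (L : ContinuousMultilinearMap ℝ (fun _ : ι => VF d) (VF d)) (k : ℕ) :
    MultilinearMap ℝ (fun _ : ι => Jet d k) (Pt d) :=
  (VF.eval 0).toLinearMap.compMultilinearMap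
    (L.toMultilinearMap.compLinearMap fun _ => jetField k)

theorem jetForm_apply (k : ℕ) (z : ι → Jet d k) :
    jetForm L k z = L (fun i => jetField k (z i)) 0 := rfl

theorem HasOrderLE.apply_congr [Finite ι] {k : ℕ} (hk : HasOrderLE k L) {f g : ι → VF d}
    (h : ∀ i, jet k (f i) = jet k (g i)) : L f 0 = L g 0 :=
  map_eq_map_of_sub_mem
    (L := (VF.eval (0 : Pt d)).toLinearMap.compMultilinearMap L.toMultilinearMap)
    (K := fun _ => {f | jet k f = 0}) hk fun i => (jet_sub k _ _).trans (sub_eq_zero.2 (h i))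

theorem HasOrderLE.apply_eq_jetForm [Finite ι] {k : ℕ} (hk : HasOrderLE k L) (f : ι → VF d) :
    L f 0 = jetForm L k fun i => jet k (f i) :=
  hk.apply_congr fun _ => (jet_jetField _ _).symm

theorem HasOrderLE.apply_homField [Finite ι] {k : ℕ} (hk : HasOrderLE k L) (δ : ι → ℕ)
    (z : ∀ i, symJet d (δ i)) :
    L (fun i => homField (δ i) (z i)) 0 = jetForm L k fun i => jetSingle k (δ i) (z i) := by
  simp only [hk.apply_eq_jetForm, jet_homField]

end FiniteOrder

/-! ### Multilinear differential operators -/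

section JetOp

variable {d : ℕ} {ι : Type*} {a : ι → ℕ}

/-- Smoothness is only available on the ambient normed spaces, so `t` is extended to all continuous
multilinear maps. -/
theorem exists_contDiff_extension [Fintype ι]
    (t : MultilinearMap ℝ (fun i => symJet d (a i)) (Pt d)) :
    ∃ Ψ : (∀ i, Pt d [×a i]→L[ℝ] Pt d) → Pt d, ContDiff ℝ ∞ Ψ ∧
      ∀ z : ∀ i, symJet d (a i), Ψ (fun i => z i) = t z := by
  have h : ∀ j, ∃ r : (Pt d [×j]→L[ℝ] Pt d) →ₗ[ℝ] symJet d j,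
      r ∘ₗ (symJet d j).subtype = LinearMap.id := fun j =>
    LinearMap.exists_leftInverse_of_injective _ (Submodule.ker_subtype _)
  choose r hr using h
  refine ⟨t.compLinearMap fun i => r (a i), contDiff_multilinear _, fun z => ?_⟩
  rw [MultilinearMap.compLinearMap_apply]
  exact congrArg t (funext fun i => LinearMap.congr_fun (hr (a i)) (z i))

theorem contDiffFamily_comp_jetAt [Finite ι]
    (t : MultilinearMap ℝ (fun i => symJet d (a i)) (Pt d)) :
    ContDiffFamily fun (f : ι → VF d) x => t fun i => jetAt x (a i) (f i) := by
  cases nonempty_fintype ι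
  obtain ⟨Ψ, hΨ, hΨt⟩ := exists_contDiff_extension t
  have hjets : ContDiffFamily fun (f : ι → VF d) x i => iteratedFDeriv ℝ (a i) (f i) x :=
    .pi fun i => (VF.continuous_iff_contDiffFamily.1 (continuous_apply i)).iteratedFDeriv (a i)
  simpa only [← coe_jetAt, hΨt] using hjets.comp_left hΨ

/-- The multilinear differential operator `f ↦ (x ↦ t (jets of f at x))`. -/
def jetOp [Finite ι] (t : MultilinearMap ℝ (fun i => symJet d (a i)) (Pt d)) :
    ContinuousMultilinearMap ℝ (fun _ : ι => VF d) (VF d) where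
  toFun f := ⟨fun x => t.compLinearMap (fun i => jetAt x (a i)) f,
    (contDiffFamily_comp_jetAt t).contDiff f⟩
  map_update_add' f i g g' := VF.ext fun _ => MultilinearMap.map_update_add _ f i g g'
  map_update_smul' f i c g := VF.ext fun _ => MultilinearMap.map_update_smul _ f i c g
  cont := VF.continuous_iff_contDiffFamily.2 (contDiffFamily_comp_jetAt t)

variable [Finite ι] (t : MultilinearMap ℝ (fun i => symJet d (a i)) (Pt d))

theorem jetOp_apply (f : ι → VF d) (x : Pt d) :
    jetOp t f x = t fun i => jetAt x (a i) (f i) := rfl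

theorem dependsOnGerms_jetOp : DependsOnGerms (jetOp t) := fun f g x h => by
  rw [jetOp_apply, jetOp_apply]
  exact congrArg t (funext fun i =>
    Subtype.ext (EventuallyEq.iteratedFDeriv ℝ (h i) (a i)).eq_of_nhds)

theorem jetAt_affAct (A : Pt d ≃L[ℝ] Pt d) (b : Pt d) (f : VF d) (x : Pt d) (j : ℕ) :
    jetAt x j (affAct A b f) = jetAct A j (jetAt (A.symm (x - b)) j f) := by
  refine Subtype.ext ?_
  have hf : ContDiff ℝ ∞ ((f : Pt d → Pt d) ∘ A.symm) := f.contDiff.comp A.symm.contDiff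
  have hleft := (A : Pt d →L[ℝ] Pt d).iteratedFDeriv_comp_left (hf.contDiffAt (x := x - b))
    (i := j) (by exact_mod_cast le_top)
  have hright := (A.symm : Pt d →L[ℝ] Pt d).iteratedFDeriv_comp_right f.contDiff (x - b)
    (i := j) (by exact_mod_cast le_top)
  calc iteratedFDeriv ℝ j (fun x => (A ∘ (f ∘ A.symm)) (x - b)) x
      = iteratedFDeriv ℝ j (A ∘ (f ∘ A.symm)) (x - b) := iteratedFDeriv_comp_sub j b x
    _ = _ := hleft.trans (congrArg (A : Pt d →L[ℝ] Pt d).compContinuousMultilinearMap hright)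

variable {t}

theorem isEquivariantMulti_jetOp {H : Subgroup (Pt d ≃L[ℝ] Pt d)}
    (ht : ∀ A ∈ H, ∀ z, t (fun i => jetAct A (a i) (z i)) = A (t z)) :
    IsEquivariantMulti H (jetOp t) := fun A hA b f => VF.ext fun x => by
  rw [jetOp_apply]
  simp only [jetAt_affAct]
  exact ht A hA _

end JetOp

theorem jetAct_inv_jetAct {d : ℕ} (A : Pt d ≃L[ℝ] Pt d) (j : ℕ) (z : symJet d j) :
    jetAct A⁻¹ j (jetAct A j z) = z := by
  refine Subtype.ext (ContinuousMultilinearMap.ext fun v => ?_)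
  change A.symm (A (z.1 fun i => A.symm (A (v i)))) = z.1 v
  simp

theorem symInv_apply_jetAct {d : ℕ} {κ : ℕ →₀ ℕ} {H : Subgroup (Pt d ≃L[ℝ] Pt d)} (t : symInv κ H)
    {A : Pt d ≃L[ℝ] Pt d} (hA : A ∈ H) (z : (p : Σ j : ℕ, Fin (κ j)) → symJet d p.1) :
    t.1 (fun p => jetAct A p.1 (z p)) = A (t.1 z) := by
  rw [← t.2.2 A hA]
  simp only [jetAct_inv_jetAct]

/-! ### Compositions -/

section Compositions

variable {m : ℕ}

theorem nonempty_equiv_sigma (κ : ℕ →₀ ℕ) : Nonempty (Fin κ.degree ≃ Σ j : ℕ, Fin (κ j)) := by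
  let e : (Σ j : κ.support, Fin (κ j)) ≃ Σ j : ℕ, Fin (κ j) :=
    { toFun := fun p => ⟨p.1, p.2⟩
      invFun := fun p => ⟨⟨p.1, Finsupp.mem_support_iff.2 fun h => (h ▸ p.2 : Fin 0).elim0⟩, p.2⟩
      left_inv := fun _ => rfl
      right_inv := fun _ => rfl }
  refine ⟨(Fintype.equivFinOfCardEq ?_).symm.trans e⟩
  simpa only [Fintype.card_sigma, Fintype.card_fin, Finsupp.degree_apply] using
    Finset.sum_coe_sort κ.support κ

instance fintypeSigmaFin (κ : ℕ →₀ ℕ) : Fintype (Σ j : ℕ, Fin (κ j)) :=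
  .ofEquiv _ (nonempty_equiv_sigma κ).some

/-- An enumeration of the arguments of the elements of `Sym_κ`. -/
def compEquiv (κ : {κ : ℕ →₀ ℕ // κ.degree = m}) : Fin m ≃ Σ j : ℕ, Fin (κ.1 j) :=
  (finCongr κ.2.symm).trans (nonempty_equiv_sigma κ.1).some

theorem exists_composition (δ : Fin m → ℕ) :
    ∃ (κ : {κ : ℕ →₀ ℕ // κ.degree = m}) (e : Fin m ≃ Σ j : ℕ, Fin (κ.1 j)),
      ∀ i, (e i).1 = δ i := by
  let κ : ℕ →₀ ℕ := Finsupp.onFinset (Finset.univ.image δ) (fun j => Fintype.card {i // δ i = j})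
    fun j hj => by
      obtain ⟨⟨i, hi⟩⟩ := Fintype.card_pos_iff.1 (Nat.pos_of_ne_zero hj)
      exact Finset.mem_image.2 ⟨i, Finset.mem_univ _, hi⟩
  let e : Fin m ≃ Σ j : ℕ, Fin (κ j) := (Equiv.sigmaFiberEquiv δ).symm.trans
    (Equiv.sigmaCongrRight fun j => Fintype.equivFinOfCardEq rfl)
  exact ⟨⟨κ, Fin.equiv_iff_eq.1 ⟨(nonempty_equiv_sigma κ).some.trans e.symm⟩⟩, e, fun _ => rfl⟩

theorem eq_of_equiv_sigma {κ κ' : ℕ →₀ ℕ} (g : (Σ j : ℕ, Fin (κ j)) ≃ Σ j : ℕ, Fin (κ' j))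
    (hg : ∀ p, (g p).1 = p.1) : κ = κ' :=
  Finsupp.ext fun j => Fin.equiv_iff_eq.1 ⟨(Equiv.sigmaSubtype j).symm.trans
    ((g.subtypeEquiv fun p => by rw [hg p]).trans (Equiv.sigmaSubtype j))⟩

end Compositions

/-! ### Restriction to jets at the origin -/

section DirectSum

variable {R ι N : Type*} {M : ι → Type*} [Semiring R] [AddCommMonoid N] [Module R N]
  [∀ i, AddCommMonoid (M i)] [∀ i, Module R (M i)]

theorem exists_linearMap_directSum (φ : ∀ i, N →ₗ[R] M i)
    (hφ : ∀ x, ∃ S : Finset ι, ∀ i ∉ S, φ i x = 0) :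
    ∃ f : N →ₗ[R] ⨁ i, M i, ∀ x i, f x i = φ i x := by
  classical
  choose S hS using hφ
  have apply_mk : ∀ x i, DirectSum.mk M (S x) (fun i => φ i x) i = φ i x := fun x i => by
    by_cases hi : i ∈ S x
    · exact DirectSum.mk_apply_of_mem hi
    · exact (DirectSum.mk_apply_of_notMem hi).trans (hS x i hi).symm
  refine ⟨{ toFun := fun x => DirectSum.mk M (S x) fun i => φ i x
            map_add' := fun x y => DirectSum.ext fun i => ?_
            map_smul' := fun c x => DirectSum.ext fun i => ?_ }, apply_mk⟩
  · rw [DirectSum.add_apply, apply_mk, apply_mk, apply_mk, map_add]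
  · rw [DirectSum.smul_apply, apply_mk, apply_mk, map_smul, RingHom.id_apply]

theorem surjective_of_forall_exists_component {f : N →ₗ[R] ⨁ i, M i}
    (hf : ∀ i t, ∃ x, f x i = t ∧ ∀ j ≠ i, f x j = 0) : Function.Surjective f := by
  classical
  rw [← LinearMap.range_eq_top, eq_top_iff, ← DFinsupp.iSup_range_lsingle]
  refine iSup_le fun i => ?_
  rintro _ ⟨t, rfl⟩
  obtain ⟨x, hself, hne⟩ := hf i t
  refine ⟨x, DirectSum.ext fun j => ?_⟩
  rcases eq_or_ne j i with rfl | hj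
  · exact hself.trans (DirectSum.of_eq_same j t).symm
  · exact (hne j hj).trans (DirectSum.of_eq_of_ne i j t hj).symm

end DirectSum

section JetRestriction

variable {d m : ℕ} {H : Subgroup (Pt d ≃L[ℝ] Pt d)}

theorem homField_jetAct (A : Pt d ≃L[ℝ] Pt d) (j : ℕ) (z : symJet d j) :
    homField j (jetAct A j z) = affAct A 0 (homField j z) := by
  refine VF.ext fun x => ?_
  change (j.factorial : ℝ)⁻¹ • A (z.1 fun _ => A.symm x) =
    A ((j.factorial : ℝ)⁻¹ • z.1 fun _ => A.symm (x - 0))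
  rw [map_smul, sub_zero]

/-- The component in `Sym_κ^H` of a local operator. -/
def component (κ : {κ : ℕ →₀ ℕ // κ.degree = m}) : linLoc H m →ₗ[ℝ] symInv κ.1 H where
  toFun L := ⟨(VF.eval 0).toLinearMap.compMultilinearMap
      ((L.1.toMultilinearMap.domDomCongr (compEquiv κ)).compLinearMap fun p => homField p.1),
    fun σ z => congrArg (VF.eval 0) <| IsSymm.map_comp_equiv L.2.1
      ((compEquiv κ).trans (Equiv.sigmaCongrRight σ)) (compEquiv κ) fun p => homField p.1 (z p),
    fun A hA z => by
      change A (L.1 (fun i => homField (compEquiv κ i).1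
        (jetAct A⁻¹ _ (z (compEquiv κ i)))) 0) = L.1 _ 0
      simp only [homField_jetAct]
      rw [L.2.2.2 A⁻¹ (H.inv_mem hA)]
      change A (A.symm (L.1 _ (A (0 - 0)))) = _
      rw [sub_zero, map_zero, A.apply_symm_apply]⟩
  map_add' _ _ := rfl
  map_smul' _ _ := rfl

theorem component_apply (L : linLoc H m) (κ : {κ : ℕ →₀ ℕ // κ.degree = m})
    (e : Fin m ≃ Σ j : ℕ, Fin (κ.1 j)) (z : (p : Σ j : ℕ, Fin (κ.1 j)) → symJet d p.1) :
    (component κ L).1 z = L.1 (fun i => homField (e i).1 (z (e i))) 0 :=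
  congrArg (VF.eval 0) <|
    IsSymm.map_comp_equiv L.2.1 (compEquiv κ) e fun p => homField p.1 (z p)

theorem exists_finset_component_eq_zero (L : linLoc H m) :
    ∃ S : Finset {κ : ℕ →₀ ℕ // κ.degree = m}, ∀ κ ∉ S, component κ L = 0 := by
  obtain ⟨k, hk⟩ := DependsOnGerms.exists_hasOrderLE L.2.2.1.2
  refine ⟨(Finset.finsuppAntidiag (Finset.range (k + 1)) m).subtype _, fun κ hκ => ?_⟩
  have hsupp : ¬ κ.1.support ⊆ Finset.range (k + 1) := fun h =>
    hκ (Finset.mem_subtype.2 (Finset.mem_finsuppAntidiag'.2 ⟨κ.2, h⟩))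
  obtain ⟨j, hj, hjk⟩ := Finset.not_subset.1 hsupp
  let p : Σ j : ℕ, Fin (κ.1 j) := ⟨j, 0, Nat.pos_of_ne_zero (Finsupp.mem_support_iff.1 hj)⟩
  refine Subtype.ext (MultilinearMap.ext fun z => ?_)
  rw [component_apply L κ (compEquiv κ)]
  refine hk _ ((compEquiv κ).symm p) ?_
  rw [Equiv.apply_symm_apply, jet_homField, jetSingle, dif_neg (by simpa using hjk)]

/-- The restriction of local operators to jets at the origin. -/
def jetRestriction (H : Subgroup (Pt d ≃L[ℝ] Pt d)) (m : ℕ) : linLoc H m →ₗ[ℝ] SymSum H m :=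
  (exists_linearMap_directSum component exists_finset_component_eq_zero).choose

theorem jetRestriction_apply (L : linLoc H m) (κ : {κ : ℕ →₀ ℕ // κ.degree = m}) :
    jetRestriction H m L κ = component κ L :=
  (exists_linearMap_directSum component exists_finset_component_eq_zero).choose_spec L κ

theorem isJetRestriction_jetRestriction (L : linLoc H m) :
    IsJetRestriction L.1 (jetRestriction H m L) := by
  obtain ⟨k, hk⟩ := DependsOnGerms.exists_hasOrderLE L.2.2.1.2
  refine ⟨k, jetForm L.1 k, hk.apply_eq_jetForm, fun κ e z => ?_⟩
  rw [jetRestriction_apply, component_apply L κ e, hk.apply_homField]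

theorem apply_homField_eq_zero {L : linLoc H m} (hL : ∀ κ, component κ L = 0) (δ : Fin m → ℕ)
    (z : ∀ i, symJet d (δ i)) : L.1 (fun i => homField (δ i) (z i)) 0 = 0 := by
  obtain ⟨κ, e, he⟩ := exists_composition δ
  obtain rfl : (fun i => (e i).1) = δ := funext he
  have h := component_apply L κ e
    (Equiv.piCongrLeft (fun p : Σ j : ℕ, Fin (κ.1 j) => symJet d p.1) e z)
  rw [hL] at h
  simp only [Equiv.piCongrLeft_apply_apply] at h
  exact h.symm

theorem apply_zero_eq_zero {L : linLoc H m} (hL : ∀ κ, component κ L = 0) (f : Fin m → VF d) :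
    L.1 f 0 = 0 := by
  obtain ⟨k, hk⟩ := DependsOnGerms.exists_hasOrderLE L.2.2.1.2
  rw [hk.apply_eq_jetForm, jetForm_apply]
  simp only [jetField_apply]
  rw [L.1.map_sum, ← VF.eval_apply, map_sum]
  exact Finset.sum_eq_zero fun δ _ => apply_homField_eq_zero hL (fun i => δ i) _

theorem apply_affAct_one_neg (L : linLoc H m) (f : Fin m → VF d) (x : Pt d) :
    L.1 (fun i => affAct 1 (-x) (f i)) 0 = L.1 f x := by
  rw [L.2.2.2 1 H.one_mem]
  change L.1 f (0 - -x) = _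
  rw [sub_neg_eq_add, zero_add]

theorem jetRestriction_injective : Function.Injective (jetRestriction H m) := by
  refine (injective_iff_map_eq_zero _).2 fun L hL => ?_
  have hcomp : ∀ κ, component κ L = 0 := fun κ => by rw [← jetRestriction_apply, hL]; rfl
  refine Subtype.ext (ContinuousMultilinearMap.ext fun f => VF.ext fun x => ?_)
  rw [← apply_affAct_one_neg]
  exact apply_zero_eq_zero hcomp _

/-! ### Operators with prescribed jet restriction -/

theorem apply_jetPart_homField_of_preserving {κ : ℕ →₀ ℕ}
    {t : MultilinearMap ℝ (fun p : (Σ j : ℕ, Fin (κ j)) => symJet d p.1) (Pt d)}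
    (ht : t ∈ symSpace d κ) {g : Equiv.Perm (Σ j : ℕ, Fin (κ j))} (hg : ∀ p, (g p).1 = p.1)
    (z : (p : Σ j : ℕ, Fin (κ j)) → symJet d p.1) :
    t (fun p => jetPart p.1 (homField (g p).1 (z (g p)))) = t z := by
  obtain ⟨σ, rfl⟩ := exists_sigmaCongrRight_eq g hg
  rw [← ht σ z]
  exact congrArg t (funext fun p => jetPart_homField_self p.1 _)

theorem apply_jetPart_homField_of_not_preserving {κ κ' : ℕ →₀ ℕ}
    (t : MultilinearMap ℝ (fun p : (Σ j : ℕ, Fin (κ j)) => symJet d p.1) (Pt d))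
    {g : (Σ j : ℕ, Fin (κ j)) → Σ j : ℕ, Fin (κ' j)} (hg : ¬ ∀ p, (g p).1 = p.1)
    (z : (p : Σ j : ℕ, Fin (κ' j)) → symJet d p.1) :
    t (fun p => jetPart p.1 (homField (g p).1 (z (g p)))) = 0 := by
  obtain ⟨p, hp⟩ := not_forall.1 hg
  exact t.map_coord_zero p (jetPart_homField_of_ne (Ne.symm hp) _)

theorem symmetrize_jetOp_apply_homField {κ κ' : ℕ →₀ ℕ} (e : Fin m ≃ Σ j : ℕ, Fin (κ j))
    (e' : Fin m ≃ Σ j : ℕ, Fin (κ' j))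
    (t : MultilinearMap ℝ (fun p : (Σ j : ℕ, Fin (κ j)) => symJet d p.1) (Pt d))
    (z : (p : Σ j : ℕ, Fin (κ' j)) → symJet d p.1) :
    symmetrize ((jetOp t).domDomCongr e.symm) (fun i => homField (e' i).1 (z (e' i))) 0 =
      ∑ g : (Σ j : ℕ, Fin (κ j)) ≃ Σ j : ℕ, Fin (κ' j),
        t fun p => jetPart p.1 (homField (g p).1 (z (g p))) := by
  rw [symmetrize_apply, ← VF.eval_apply, map_sum, ← Equiv.sum_comp (Equiv.equivCongr e e')]
  rfl

theorem exists_symmetrize_jetOp_apply_eq_smul {κ : ℕ →₀ ℕ} (e : Fin m ≃ Σ j : ℕ, Fin (κ j))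
    {t : MultilinearMap ℝ (fun p : (Σ j : ℕ, Fin (κ j)) => symJet d p.1) (Pt d)}
    (ht : t ∈ symSpace d κ) :
    ∃ c : ℕ, c ≠ 0 ∧ ∀ z : (p : Σ j : ℕ, Fin (κ j)) → symJet d p.1,
      symmetrize ((jetOp t).domDomCongr e.symm) (fun i => homField (e i).1 (z (e i))) 0 =
        c • t z := by
  refine ⟨({g | ∀ p, (g p).1 = p.1} : Finset (Equiv.Perm (Σ j : ℕ, Fin (κ j)))).card,
    Finset.card_ne_zero_of_mem (a := 1) (by simp), fun z => ?_⟩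
  rw [symmetrize_jetOp_apply_homField, ← Finset.sum_const, Finset.sum_filter]
  refine Finset.sum_congr rfl fun g _ => ?_
  split_ifs with hg
  · exact apply_jetPart_homField_of_preserving ht hg z
  · exact apply_jetPart_homField_of_not_preserving t hg z

theorem symmetrize_jetOp_apply_eq_zero {κ κ' : ℕ →₀ ℕ} (h : κ ≠ κ')
    (e : Fin m ≃ Σ j : ℕ, Fin (κ j)) (e' : Fin m ≃ Σ j : ℕ, Fin (κ' j))
    (t : MultilinearMap ℝ (fun p : (Σ j : ℕ, Fin (κ j)) => symJet d p.1) (Pt d))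
    (z : (p : Σ j : ℕ, Fin (κ' j)) → symJet d p.1) :
    symmetrize ((jetOp t).domDomCongr e.symm) (fun i => homField (e' i).1 (z (e' i))) 0 = 0 := by
  rw [symmetrize_jetOp_apply_homField]
  exact Finset.sum_eq_zero fun g _ =>
    apply_jetPart_homField_of_not_preserving t (fun hg => h (eq_of_equiv_sigma g hg)) z

theorem exists_component_eq (hm : 1 ≤ m) (κ : {κ : ℕ →₀ ℕ // κ.degree = m}) (t : symInv κ.1 H) :
    ∃ L : linLoc H m, component κ L = t ∧ ∀ κ' ≠ κ, component κ' L = 0 := by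
  obtain ⟨c, hc, hself⟩ := exists_symmetrize_jetOp_apply_eq_smul (compEquiv κ) t.2.1
  have hmem : symmetrize ((jetOp t.1).domDomCongr (compEquiv κ).symm) ∈ linLoc H m :=
    symmetrize_mem_linLoc hm (fun f g x h => dependsOnGerms_jetOp t.1 _ _ x fun _ => h _)
      fun A hA b f => isEquivariantMulti_jetOp (fun _ hA => symInv_apply_jetAct t hA) A hA b _
  refine ⟨(c : ℝ)⁻¹ • ⟨_, hmem⟩, ?_, fun κ' hκ => ?_⟩
  · refine Subtype.ext (MultilinearMap.ext fun z => ?_)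
    rw [map_smul]
    change (c : ℝ)⁻¹ • (component κ _).1 z = _
    rw [component_apply _ κ (compEquiv κ), hself, ← Nat.cast_smul_eq_nsmul ℝ,
      inv_smul_smul₀ (Nat.cast_ne_zero.2 hc)]
  · refine (map_smul (component κ') (c : ℝ)⁻¹ _).trans (smul_eq_zero_of_right _ ?_)
    refine Subtype.ext (MultilinearMap.ext fun z => ?_)
    rw [component_apply _ κ' (compEquiv κ')]
    exact symmetrize_jetOp_apply_eq_zero (fun h => hκ (Subtype.ext h.symm)) _ _ t.1 z

theorem jetRestriction_surjective (hm : 1 ≤ m) : Function.Surjective (jetRestriction H m) :=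
  surjective_of_forall_exists_component fun κ t => by
    simpa only [jetRestriction_apply] using exists_component_eq hm κ t

end JetRestriction

/-- The passage from a multilinear map to its homogeneous polynomial, as a linear map. -/
def homPolyₗ (d m : ℕ) :
    ContinuousMultilinearMap ℝ (fun _ : Fin m => VF d) (VF d) →ₗ[ℝ] (VF d → VF d) where
  toFun L := homPoly L
  map_add' _ _ := rfl
  map_smul' _ _ := rfl

end AffineTaylor

end

theorem mainTheorem3 (d : ℕ) (H : Subgroup (Pt d ≃L[ℝ] Pt d)) (m : ℕ) (hm : 1 ≤ m) :
    ∃ J : linLoc H m ≃ₗ[ℝ] SymSum H m,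
      (∀ L : linLoc H m, IsJetRestriction L.1 (J L)) ∧
      ∃ B : SymSum H m →ₗ[ℝ] (VF d → VF d),
        (∀ s : SymSum H m, B s = homPoly (J.symm s).1) ∧
        Function.Injective B ∧ Set.range B = taylorTerms H m := by
  let J : linLoc H m ≃ₗ[ℝ] SymSum H m :=
    .ofBijective (jetRestriction H m) ⟨jetRestriction_injective, jetRestriction_surjective hm⟩
  refine ⟨J, isJetRestriction_jetRestriction,
    homPolyₗ d m ∘ₗ (linLoc H m).subtype ∘ₗ J.symm.toLinearMap, fun _ => rfl, fun s s' h => ?_, ?_⟩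
  · exact J.symm.injective
      (Subtype.ext (IsSymm.eq_of_homPoly_eq (J.symm s).2.1 (J.symm s').2.1 h))
  · calc Set.range (homPolyₗ d m ∘ₗ (linLoc H m).subtype ∘ₗ J.symm.toLinearMap)
        = Set.range (homPolyₗ d m ∘ (linLoc H m).subtype) :=
          J.symm.surjective.range_comp (homPolyₗ d m ∘ (linLoc H m).subtype)
      _ = homPolyₗ d m '' (linLoc H m : Set _) := by
          rw [Set.range_comp, Submodule.coe_subtype, Subtype.range_coe]
      _ = taylorTerms H m := (taylorTerms_eq_image hm H).symm
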